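/- **Setting.** Let $\mathsf X,\mathsf Y$ be Polish spaces with their Borel $\sigma$-fields. A hidden Markov chain on $\mathsf X$ has initial law $\chi$ and transition kernel $M(x,dx')=q(x,x')\,\mu(dx')$, where $\mu$ is a $\sigma$-finite reference measure; given $X_k=x$, the observation $Y_k$ has density $g(x,\cdot)$ with respect to a reference measure on $\mathsf Y$. Fix $n\ge 0$ and observations $y_{0:n}$, write $g_k(x)=g(x,y_k)$, and assume that $$Z_n=\int \chi(dx_0)\,g_0(x_0)\prod_{k=1}^n q(x_{k-1},x_k)\,g_k(x_k)\,\mu(dx_k)>0 .$$ The joint smoothing distribution $\phi_{0:n|n}$ on $\mathsf X^{n+1}$ is $Z_n^{-1}\,\chi(dx_0)\,g_0(x_0)\prod_{k=1}^n q(x_{k-1},x_k)\,g_k(x_k)\,\mu(dx_k)$. **Particle filter.** Let $\rho_0$ be a probability measure with $\chi\ll\rho_0$ and a given finite version of $d\chi/d\rho_0$. For $0\le k<n$ let $\vartheta_k:\mathsf X\to[0,\infty)$ be measurable and let $r_k\ge 0$ be a transition density with respect to $\mu$. Put $$\omega_0=g_0\,\frac{d\chi}{d\rho_0},\qquad \omega_{k+1}(x,x')=\frac{g_{k+1}(x')\,q(x,x')}{\vartheta_k(x)\,r_k(x,x')},$$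 with $0/0=0$ and $a/0=\infty$ for $a>0$. With $N\ge 1$ particles: draw $\xi_0^1,\dots,\xi_0^N$ independently from $\rho_0$ and set $\omega_0^i=\omega_0(\xi_0^i)$; given the sample at time $k$, draw independently for $i=1,\dots,N$ an ancestor index $I_{k+1}^i$ with probabilities proportional to $(\omega_k^\ell\vartheta_k(\xi_k^\ell))_{\ell}$ and then $\xi_{k+1}^i$ from the density $r_k(\xi_k^{I_{k+1}^i},\cdot)$, and set $\omega_{k+1}^i=\omega_{k+1}(\xi_k^{I_{k+1}^i},\xi_{k+1}^i)$. The likelihood estimate of this particle system is $$Z_n^N=\frac1{N^{n+1}}\Big(\prod_{k=0}^{n-1}\sum_{\ell=1}^N\omega_k^\ell\vartheta_k(\xi_k^\ell)\Big)\sum_{\ell=1}^N\omega_n^\ell .$$ *Backward sampling* draws $J_n$ with probabilities proportional to $(\omega_n^i)_i$ and, for $k=n-1,\dots,0$, $J_k$ with probabilities proportional to $(\omega_k^i\,q(\xi_k^i,\xi_{k+1}^{J_{k+1}}))_i$, and returns $(\xi_0^{J_0},\dots,\xi_n^{J_n})$. If all weights in such a draw vanish, the index is drawn uniformly. **MCMC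 sampler.** The state is a trajectory together with a particle system, the latter with likelihood estimate $Z$. In one update a new particle system, with estimate $Z^*$, is generated independently of the past, and a trajectory is drawn from it by backward sampling; the new pair is accepted with probability $1\wedge (Z^*/Z)$ (where $a/0=\infty$ for $a>0$, $0/0=0$), otherwise the state is unchanged. Let $(X_{0:n}^{(\ell)})_{\ell\ge0}$ be the trajectories of this chain. **Statement.** Assume that $\|\omega_k\|_\infty<\infty$ for $0\le k\le n$ and $\|\vartheta_k\|_\infty<\infty$ for $0\le k<n$. Then for every $N\ge1$ there is a constant $c>0$ such that for all bounded measurable $h:\mathsf X^{n+1}\to\mathbb R$, all $m\ge1$, all initial trajectories $X^{(0)}_{0:n}=x_{0:n}\in\mathsf X^{n+1}$ (with an arbitrary, possibly random, initial particle system), and all $\varepsilon>0$, $$\mathbb P\left(\left|\frac1m\sum_{\ell=0}^m h\big(X^{(\ell)}_{0:n}\big)-\phi_{0:n|n}(h)\right|\ge\varepsilon\right)\le c\,\exp\left(-\frac mc\left\{\frac{\varepsilon^2}{\|h\|_\infty^2}\wedge\frac{\varepsilon}{\|h\|_\infty}\right\}\right),$$ where $\|h\|_\infty=\sup|h|$ (for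 $h=0$ the left-hand side is $0$). -/

import Mathlib

open MeasureTheory
open scoped ENNReal NNReal

/-- A fully dominated state-space model: the hidden Markov chain lives on `X`, the observations
live on `Y`. -/
structure StateSpaceModel (X Y : Type*) [MeasurableSpace X] [MeasurableSpace Y] where
  /-- reference measure on the state space -/
  refX : Measure X
  /-- reference measure on the observation space -/
  refY : Measure Y
  /-- initial distribution of the hidden chain -/
  init : Measure X
  /-- transition density: the transition kernel is `A ↦ ∫ x' in A, q x x' ∂refX` -/
  q : X → X → ℝ≥0
  /-- emission density: the law of an observation given the state `x` is `g x y ∂refY` -/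
  g : X → Y → ℝ≥0
  sigmaFinite_refX : SigmaFinite refX
  isProbabilityMeasure_init : IsProbabilityMeasure init
  measurable_q : Measurable (Function.uncurry q)
  measurable_g : Measurable (Function.uncurry g)
  lintegral_q : ∀ x, ∫⁻ x', (q x x' : ℝ≥0∞) ∂refX = 1
  lintegral_g : ∀ x, ∫⁻ y, (g x y : ℝ≥0∞) ∂refY = 1

/-- The ingredients of an auxiliary particle filter with time horizon `n` for the model `M`. -/
structure AuxiliaryParticleFilter {X Y : Type*} [MeasurableSpace X] [MeasurableSpace Y]
    (M : StateSpaceModel X Y) (n : ℕ) where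
  /-- instrumental distribution of the initial particles -/
  instr : Measure X
  /-- a version of the density of `M.init` with respect to `instr` -/
  initDens : X → ℝ≥0
  /-- adjustment multiplier functions -/
  adj : Fin n → X → ℝ≥0
  /-- proposal transition densities with respect to `M.refX` -/
  r : Fin n → X → X → ℝ≥0
  isProbabilityMeasure_instr : IsProbabilityMeasure instr
  measurable_initDens : Measurable initDens
  measurable_adj : ∀ k, Measurable (adj k)
  measurable_r : ∀ k, Measurable (Function.uncurry (r k))
  init_eq : M.init = instr.withDensity (fun x => (initDens x : ℝ≥0∞))
  lintegral_r : ∀ k x, ∫⁻ x', (r k x x' : ℝ≥0∞) ∂M.refX = 1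

/-- State trajectories `x_{0:n}`. -/
abbrev Trajectory (X : Type*) (n : ℕ) : Type _ := Fin (n + 1) → X

/-- All random variables produced by a run of the particle filter: the particles `s.1 k i`,
at times `k = 0, …, n`, and the ancestor indices: `s.2 k i` is the index, in the sample at time
`k`, of the ancestor of the `i`th particle at time `k + 1`. -/
abbrev ParticleSystem (X : Type*) (n N : ℕ) : Type _ :=
  (Fin (n + 1) → Fin N → X) × (Fin n → Fin N → Fin N)

/-- The probability vector on `Fin N` proportional to the weights `w`; the uniform
distribution in the degenerate case where all weights vanish. -/
noncomputable def normalizedWeight {N : ℕ} (w : Fin N → ℝ≥0∞) (i : Fin N) : ℝ≥0∞ :=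
  open Classical in if ∑ l, w l = 0 then (N : ℝ≥0∞)⁻¹ else w i / ∑ l, w l

namespace StateSpaceModel

variable {X Y : Type*} [MeasurableSpace X] [MeasurableSpace Y]

/-- The measure
`init(dx_0) g(x_0, y_0) ∏_{k=1}^n q(x_{k-1}, x_k) g(x_k, y_k) refX(dx_k)` on trajectories. -/
noncomputable def jointMeasure (M : StateSpaceModel X Y) {n : ℕ} (y : Fin (n + 1) → Y) :
    Measure (Trajectory X n) :=
  (Measure.pi (fun k : Fin (n + 1) => if k = 0 then M.init else M.refX)).withDensity
    (fun x => (∏ k : Fin (n + 1), (M.g (x k) (y k) : ℝ≥0∞)) *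
      ∏ k : Fin n, (M.q (x k.castSucc) (x k.succ) : ℝ≥0∞))

/-- The normalising constant (the likelihood of the observations). -/
noncomputable def likelihood (M : StateSpaceModel X Y) {n : ℕ} (y : Fin (n + 1) → Y) : ℝ≥0∞ :=
  M.jointMeasure y Set.univ

/-- The joint smoothing distribution: the conditional law of the states at times `0, …, n` given
the observations `y` at times `0, …, n`. -/
noncomputable def smoothing (M : StateSpaceModel X Y) {n : ℕ} (y : Fin (n + 1) → Y) :
    Measure (Trajectory X n) :=
  (M.likelihood y)⁻¹ • M.jointMeasure y

end StateSpaceModel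

namespace AuxiliaryParticleFilter

variable {X Y : Type*} [MeasurableSpace X] [MeasurableSpace Y] {M : StateSpaceModel X Y} {n : ℕ}

/-- The importance weight function at time `0`. -/
noncomputable def weightFunZero (F : AuxiliaryParticleFilter M n) (y : Fin (n + 1) → Y)
    (x : X) : ℝ≥0∞ :=
  (M.g x (y 0) : ℝ≥0∞) * F.initDens x

/-- The importance weight function at time `k + 1`, with the conventions `0 / 0 = 0` and
`a / 0 = ∞` for `a > 0`. -/
noncomputable def weightFunSucc (F : AuxiliaryParticleFilter M n) (y : Fin (n + 1) → Y)
    (k : Fin n) (x x' : X) : ℝ≥0∞ :=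
  ((M.g x' (y k.succ) : ℝ≥0∞) * M.q x x') / ((F.adj k x : ℝ≥0∞) * F.r k x x')

/-- The importance weight functions and the adjustment multiplier functions are bounded. -/
structure BoundedWeights (F : AuxiliaryParticleFilter M n) (y : Fin (n + 1) → Y) : Prop where
  weightFunZero_bdd : ⨆ x, F.weightFunZero y x < ∞
  weightFunSucc_bdd : ∀ k, ⨆ x, ⨆ x', F.weightFunSucc y k x x' < ∞
  adj_bdd : ∀ k, ⨆ x, (F.adj k x : ℝ≥0∞) < ∞

variable {N : ℕ}

/-- The importance weight of the `i`th particle at time `k`. -/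
noncomputable def weight (F : AuxiliaryParticleFilter M n) (y : Fin (n + 1) → Y)
    (s : ParticleSystem X n N) (k : Fin (n + 1)) (i : Fin N) : ℝ≥0∞ :=
  Fin.cases (motive := fun _ => ℝ≥0∞) (F.weightFunZero y (s.1 0 i))
    (fun l => F.weightFunSucc y l (s.1 l.castSucc (s.2 l i)) (s.1 l.succ i)) k

/-- The density, at `(i, x)`, of the law from which the pairs (ancestor index, particle) at time
`k + 1` are drawn given the sample at time `k`. -/
noncomputable def auxProposal (F : AuxiliaryParticleFilter M n) (y : Fin (n + 1) → Y)
    (s : ParticleSystem X n N) (k : Fin n) (i : Fin N) (x : X) : ℝ≥0∞ :=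
  normalizedWeight (fun l => F.weight y s k.castSucc l * F.adj k (s.1 k.castSucc l)) i *
    F.r k (s.1 k.castSucc i) x

/-- The law of the particles and ancestor indices generated by the particle filter. -/
noncomputable def filterLaw (F : AuxiliaryParticleFilter M n) (y : Fin (n + 1) → Y) (N : ℕ) :
    Measure (ParticleSystem X n N) :=
  ((Measure.pi (fun k : Fin (n + 1) => Measure.pi (fun _ : Fin N =>
      if k = 0 then F.instr else M.refX))).prod Measure.count).withDensity
    (fun s => ∏ k : Fin n, ∏ l : Fin N, F.auxProposal y s k (s.2 k l) (s.1 k.succ l))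

/-- The particle filter estimate of the likelihood. -/
noncomputable def likelihoodEstimate (F : AuxiliaryParticleFilter M n) (y : Fin (n + 1) → Y)
    (s : ParticleSystem X n N) : ℝ≥0∞ :=
  (∏ k : Fin n, ∑ l : Fin N, F.weight y s k.castSucc l * F.adj k (s.1 k.castSucc l)) *
    (∑ l : Fin N, F.weight y s (Fin.last n) l) / (N : ℝ≥0∞) ^ (n + 1)

/-- The probability that backward sampling in the particle system `s` draws the indices `j`:
`j n` is drawn with probabilities proportional to the weights at time `n`, and then, backwards in
time, `j k` is drawn with probabilities proportional to
(weight of particle `i` at time `k`) `* q` (particle `i` at time `k`, state drawn at `k + 1`). -/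
noncomputable def backwardProb (F : AuxiliaryParticleFilter M n) (y : Fin (n + 1) → Y)
    (s : ParticleSystem X n N) (j : Fin (n + 1) → Fin N) : ℝ≥0∞ :=
  normalizedWeight (F.weight y s (Fin.last n)) (j (Fin.last n)) *
    ∏ k : Fin n, normalizedWeight
      (fun i => F.weight y s k.castSucc i * M.q (s.1 k.castSucc i) (s.1 k.succ (j k.succ)))
      (j k.castSucc)

/-- The joint law of the trajectory returned by particle-based forward filtering backward
sampling and of the particle system from which it has been drawn. -/
noncomputable def ffbsLaw (F : AuxiliaryParticleFilter M n) (y : Fin (n + 1) → Y) (N : ℕ) :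
    Measure (Trajectory X n × ParticleSystem X n N) :=
  (((F.filterLaw y N).prod (Measure.count : Measure (Fin (n + 1) → Fin N))).withDensity
      (fun p => F.backwardProb y p.1 p.2)).map
    (fun p => ((fun k => p.1.1 k (p.2 k)), p.1))

/-- The probability of accepting a proposed particle system `s'` when the current one is `s`:
the minimum of `1` and the ratio of the likelihood estimates (a proposal with positive estimate is
accepted if the current estimate is `0`). -/
noncomputable def acceptProb (F : AuxiliaryParticleFilter M n) (y : Fin (n + 1) → Y)
    (s s' : ParticleSystem X n N) : ℝ≥0∞ :=
  min 1 (F.likelihoodEstimate y s' / F.likelihoodEstimate y s)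

/-- The probability that one update of the FFBS-based independent Metropolis-Hastings sampler,
started from the trajectory and particle system `p`, ends in the set `B`. -/
noncomputable def mhTransition (F : AuxiliaryParticleFilter M n) (y : Fin (n + 1) → Y)
    (p : Trajectory X n × ParticleSystem X n N)
    (B : Set (Trajectory X n × ParticleSystem X n N)) : ℝ≥0∞ :=
  ∫⁻ p', (F.acceptProb y p.2 p'.2 * B.indicator 1 p' +
    (1 - F.acceptProb y p.2 p'.2) * B.indicator 1 p) ∂(F.ffbsLaw y N)

/-- The process `S`, of current trajectories and current particle systems, is a run of the
FFBS-based independent Metropolis-Hastings sampler: it is a Markov chain with the transition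
probabilities `mhTransition`. -/
structure IsMHChain (F : AuxiliaryParticleFilter M n) (y : Fin (n + 1) → Y)
    {Ω : Type*} [MeasurableSpace Ω] (P : Measure Ω)
    (S : ℕ → Ω → Trajectory X n × ParticleSystem X n N) : Prop where
  measurable : ∀ l, Measurable (S l)
  markov : ∀ (l : ℕ) (A : Set (Fin (l + 1) → Trajectory X n × ParticleSystem X n N))
    (B : Set (Trajectory X n × ParticleSystem X n N)), MeasurableSet A → MeasurableSet B →
    P {ω | (fun i : Fin (l + 1) => S i ω) ∈ A ∧ S (l + 1) ω ∈ B} =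
      ∫⁻ ω in {ω | (fun i : Fin (l + 1) => S i ω) ∈ A}, F.mhTransition y (S l ω) B ∂P

end AuxiliaryParticleFilter

/-- The supremum norm of a bounded real function. -/
noncomputable def supNorm {α : Type*} (h : α → ℝ) : ℝ := ⨆ x, |h x|

section UniformlyErgodic

open ProbabilityTheory

variable {E : Type*} [MeasurableSpace E]

/-- The Markov property on rectangles determines the joint law of the path up to time `l` and of
the state at time `l + 1`. -/
lemma map_prodMk_eq_compProd_of_markov {Ω : Type*} [MeasurableSpace Ω] {P : Measure Ω}
    [IsFiniteMeasure P] (κ : Kernel E E) [IsMarkovKernel κ] {S : ℕ → Ω → E}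
    (hS : ∀ l, Measurable (S l)) {l : ℕ}
    (hP : ∀ (A : Set (Fin (l + 1) → E)) (B : Set E), MeasurableSet A → MeasurableSet B →
      P {ω | (fun i : Fin (l + 1) => S i ω) ∈ A ∧ S (l + 1) ω ∈ B} =
        ∫⁻ ω in {ω | (fun i : Fin (l + 1) => S i ω) ∈ A}, κ (S l ω) B ∂P) :
    P.map (fun ω => ((fun i : Fin (l + 1) => S i ω), S (l + 1) ω)) =
      (P.map (fun ω => (fun i : Fin (l + 1) => S i ω))) ⊗ₘ
        (κ.comap (fun p : Fin (l + 1) → E => p (Fin.last l)) (measurable_pi_apply _)) := by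
  have hp : Measurable (fun ω => (fun i : Fin (l + 1) => S i ω)) :=
    measurable_pi_lambda _ fun i => hS i
  refine Measure.ext_prod fun {A B} hA hB => ?_
  rw [Measure.map_apply (hp.prodMk (hS _)) (hA.prod hB), Measure.compProd_apply_prod hA hB,
    setLIntegral_map hA (Kernel.measurable_coe _ hB) hp]
  simpa using! hP A B hA hB

lemma lintegral_mul_of_markov {Ω : Type*} [MeasurableSpace Ω] {P : Measure Ω}
    [IsFiniteMeasure P] (κ : Kernel E E) [IsMarkovKernel κ] {S : ℕ → Ω → E}
    (hS : ∀ l, Measurable (S l)) {l : ℕ}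
    (hP : ∀ (A : Set (Fin (l + 1) → E)) (B : Set E), MeasurableSet A → MeasurableSet B →
      P {ω | (fun i : Fin (l + 1) => S i ω) ∈ A ∧ S (l + 1) ω ∈ B} =
        ∫⁻ ω in {ω | (fun i : Fin (l + 1) => S i ω) ∈ A}, κ (S l ω) B ∂P)
    {G : (Fin (l + 1) → E) → ℝ≥0∞} (hG : Measurable G) {φ : E → ℝ≥0∞} (hφ : Measurable φ) :
    ∫⁻ ω, G (fun i => S i ω) * φ (S (l + 1) ω) ∂P =
      ∫⁻ ω, G (fun i => S i ω) * ∫⁻ z, φ z ∂κ (S l ω) ∂P := by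
  have hp : Measurable (fun ω => (fun i : Fin (l + 1) => S i ω)) :=
    measurable_pi_lambda _ fun i => hS i
  have hGφ : Measurable fun q : (Fin (l + 1) → E) × E => G q.1 * φ q.2 :=
    (hG.comp measurable_fst).mul (hφ.comp measurable_snd)
  have h1 := lintegral_map (μ := P) hGφ (hp.prodMk (hS (l + 1)))
  rw [map_prodMk_eq_compProd_of_markov κ hS hP, Measure.lintegral_compProd hGφ,
    lintegral_map (Measurable.lintegral_kernel_prod_right' hGφ) hp] at h1
  rw [← h1]
  refine lintegral_congr fun ω => ?_
  simp only [Kernel.comap_apply, Fin.val_last]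
  exact lintegral_const_mul _ hφ

/-- `valueFun κ h k x` is the expectation of `h (X 0) + ⋯ + h (X k)` for the Markov chain `X` with
transition kernel `κ` started at `x`. -/
noncomputable def valueFun (κ : Kernel E E) (h : E → ℝ) : ℕ → E → ℝ
  | 0 => h
  | k + 1 => fun x => h x + ∫ z, valueFun κ h k z ∂κ x

lemma measurable_valueFun (κ : Kernel E E) [IsMarkovKernel κ] {h : E → ℝ} (hh : Measurable h) :
    ∀ k, Measurable (valueFun κ h k)
  | 0 => hh
  | k + 1 => hh.add ((measurable_valueFun κ hh k).stronglyMeasurable.integral_kernel).measurable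

lemma integrable_of_abs_sub_le {μ : Measure E} [IsFiniteMeasure μ] {u : E → ℝ}
    (hu : Measurable u) {a D : ℝ} (h : ∀ x, |u x - a| ≤ D) : Integrable u μ :=
  Integrable.of_mem_Icc (a - D) (a + D) hu.aemeasurable <| ae_of_all _ fun x => by
    have := abs_le.1 (h x)
    constructor <;> linarith

/-- Integrating against a kernel that satisfies a Doeblin condition contracts the distance to the
mean. -/
lemma abs_integral_sub_le_of_minorization {μ π : Measure E} [IsProbabilityMeasure μ]
    [IsProbabilityMeasure π] {δ : ℝ≥0} (hμ : δ • π ≤ μ) {u : E → ℝ} (hu : Measurable u)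
    {a D : ℝ} (h : ∀ x, |u x - a| ≤ D) (ha : ∫ x, u x ∂π = a) :
    |∫ x, u x ∂μ - a| ≤ (1 - δ) * D := by
  have hi : ∀ (ν : Measure E) [IsFiniteMeasure ν], Integrable u ν := fun ν _ =>
    integrable_of_abs_sub_le hu h
  have key : ∀ v : E → ℝ, Integrable v μ → (∀ x, 0 ≤ v x) →
      δ * ∫ x, v x ∂π ≤ ∫ x, v x ∂μ := fun v hv h0 => by
    have := integral_mono_measure hμ (ae_of_all _ h0) hv
    rwa [integral_smul_nnreal_measure, NNReal.smul_def, smul_eq_mul] at this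
  have h1 := key (fun x => u x - (a - D)) ((hi μ).sub (integrable_const _)) fun x => by
    linarith [abs_le.1 (h x)]
  have h2 := key (fun x => (a + D) - u x) ((integrable_const _).sub (hi μ)) fun x => by
    linarith [abs_le.1 (h x)]
  rw [integral_sub (hi _) (integrable_const _), integral_sub (hi _) (integrable_const _)] at h1
  rw [integral_sub (integrable_const _) (hi _), integral_sub (integrable_const _) (hi _)] at h2
  simp only [integral_const, probReal_univ, one_smul, ha] at h1 h2
  rw [abs_le]
  constructor <;> linarith

lemma integral_integral_of_invariant {κ : Kernel E E} {π : Measure E} [IsProbabilityMeasure π]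
    [IsMarkovKernel κ] (hκ : κ.Invariant π) {u : E → ℝ} (hu : Integrable u π) :
    ∫ x, ∫ z, u z ∂κ x ∂π = ∫ x, u x ∂π := by
  have hs : (π ⊗ₘ κ).map Prod.snd = π := (Measure.snd_compProd π κ).trans hκ.def
  have hu' : Integrable u ((π ⊗ₘ κ).map Prod.snd) := by rwa [hs]
  have h := integral_map measurable_snd.aemeasurable hu'.aestronglyMeasurable
  rw [Measure.integral_compProd (f := fun p : E × E => u p.2) (hu'.comp_measurable measurable_snd),
    hs] at h
  exact h.symm

lemma abs_valueFun_sub_le {κ : Kernel E E} [IsMarkovKernel κ] {π : Measure E}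
    [IsProbabilityMeasure π] (hπ : κ.Invariant π) {δ : ℝ≥0} (hδ : 0 < δ)
    (hκ : ∀ x, δ • π ≤ κ x) {h : E → ℝ} (hh : Measurable h) {b : ℝ} (hb : ∀ x, |h x| ≤ b)
    (hδ1 : δ ≤ 1) (k : ℕ) :
    ∫ x, valueFun κ h k x ∂π = (k + 1) * ∫ x, h x ∂π ∧
      ∀ x, |valueFun κ h k x - (k + 1) * ∫ x, h x ∂π| ≤ 2 * b / δ := by
  have hδ' : (0 : ℝ) < δ := hδ
  have hδ1' : (δ : ℝ) ≤ 1 := hδ1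
  obtain ⟨x₀⟩ : Nonempty E := nonempty_of_isProbabilityMeasure π
  have hb0 : 0 ≤ b := (abs_nonneg _).trans (hb x₀)
  have hint : Integrable h π :=
    integrable_of_abs_sub_le (a := 0) (D := b) hh (by simpa using hb)
  have hmean : |∫ x, h x ∂π| ≤ b := by
    simpa using norm_integral_le_of_norm_le_const (μ := π) (f := h) (ae_of_all _ hb)
  have hc : ∀ x, |h x - ∫ x, h x ∂π| ≤ 2 * b := fun x => by
    have h1 := abs_le.1 (hb x)
    have h2 := abs_le.1 hmean
    rw [abs_le]
    constructor <;> linarith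
  have hD : (1 - (δ : ℝ)) * (2 * b / δ) + 2 * b = 2 * b / δ := by
    field_simp
    ring
  induction k with
  | zero =>
    refine ⟨by simp [valueFun], fun x => ?_⟩
    have : 0 ≤ (1 - (δ : ℝ)) * (2 * b / δ) :=
      mul_nonneg (by linarith) (by positivity)
    simpa [valueFun] using (hc x).trans (by linarith)
  | succ k ih =>
    have hu := measurable_valueFun κ hh k
    have hstep := fun x => abs_integral_sub_le_of_minorization (hκ x) hu ih.2 ih.1
    constructor
    · simp only [valueFun]
      rw [integral_add hint
        (integrable_of_abs_sub_le (hu.stronglyMeasurable.integral_kernel).measurable hstep),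
        integral_integral_of_invariant hπ (integrable_of_abs_sub_le hu ih.2), ih.1]
      push_cast
      ring
    · intro x
      have h1 := abs_le.1 (hstep x)
      have h2 := abs_le.1 (hc x)
      simp only [valueFun]
      push_cast
      rw [abs_le]
      constructor <;> linarith

/-- Hoeffding's lemma. -/
lemma lintegral_exp_le_of_abs_sub_le {μ : Measure E} [IsProbabilityMeasure μ] {u : E → ℝ}
    (hu : Measurable u) {a D : ℝ} (h : ∀ x, |u x - a| ≤ D) (t : ℝ) :
    ∫⁻ x, ENNReal.ofReal (Real.exp (t * u x)) ∂μ ≤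
      ENNReal.ofReal (Real.exp (D ^ 2 * t ^ 2 / 2) * Real.exp (t * ∫ x, u x ∂μ)) := by
  have hIcc : ∀ x, u x ∈ Set.Icc (a - D) (a + D) := fun x => by
    have := abs_le.1 (h x)
    constructor <;> linarith
  have hs := hasSubgaussianMGF_of_mem_Icc (μ := μ) hu.aemeasurable (ae_of_all _ hIcc)
  have hm := hs.mgf_le t
  have hi := hs.integrable_exp_mul t
  have he : ∀ x, Real.exp (t * u x) =
      Real.exp (t * (u x - ∫ x, u x ∂μ)) * Real.exp (t * ∫ x, u x ∂μ) := fun x => by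
    rw [← Real.exp_add]
    ring_nf
  have hc : (((‖a + D - (a - D)‖₊ / 2) ^ 2 : ℝ≥0) : ℝ) = D ^ 2 := by
    simp only [NNReal.coe_pow, NNReal.coe_div, coe_nnnorm, Real.norm_eq_abs, NNReal.coe_ofNat]
    rw [div_pow, sq_abs]
    ring
  rw [← ofReal_integral_eq_lintegral_ofReal]
  · refine ENNReal.ofReal_le_ofReal ?_
    simp_rw [he, integral_mul_const]
    rw [hc] at hm
    exact mul_le_mul_of_nonneg_right hm (Real.exp_nonneg _)
  · simp_rw [he]
    exact hi.mul_const _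
  · exact ae_of_all _ fun x => Real.exp_nonneg _

/-- Bound for the moment generating function of the additive functional of a uniformly ergodic
Markov chain. -/
lemma lintegral_exp_sum_le {κ : Kernel E E} [IsMarkovKernel κ] {π : Measure E}
    [IsProbabilityMeasure π] (hπ : κ.Invariant π) {δ : ℝ≥0} (hδ : 0 < δ) (hδ1 : δ ≤ 1)
    (hκ : ∀ x, δ • π ≤ κ x) {h : E → ℝ} (hh : Measurable h) {b : ℝ} (hb : ∀ x, |h x| ≤ b)
    {Ω : Type*} [MeasurableSpace Ω] {P : Measure Ω} [IsProbabilityMeasure P]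
    {S : ℕ → Ω → E} (hS : ∀ l, Measurable (S l))
    (hP : ∀ (l : ℕ) (A : Set (Fin (l + 1) → E)) (B : Set E), MeasurableSet A → MeasurableSet B →
      P {ω | (fun i : Fin (l + 1) => S i ω) ∈ A ∧ S (l + 1) ω ∈ B} =
        ∫⁻ ω in {ω | (fun i : Fin (l + 1) => S i ω) ∈ A}, κ (S l ω) B ∂P)
    {t : ℝ} (ht : 0 ≤ t) (m l : ℕ) :
    ∫⁻ ω, ENNReal.ofReal (Real.exp (t * (∑ j ∈ Finset.range l, h (S j ω) +
        valueFun κ h m (S l ω)))) ∂P ≤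
      ENNReal.ofReal (Real.exp (l * ((2 * b / δ) ^ 2 * t ^ 2 / 2) +
        t * ((l + m + 1) * ∫ x, h x ∂π + 2 * b / δ))) := by
  induction l generalizing m with
  | zero =>
    refine (lintegral_mono (g := fun _ => ENNReal.ofReal (Real.exp (((0 : ℕ) : ℝ) *
      ((2 * b / δ) ^ 2 * t ^ 2 / 2) + t * ((((0 : ℕ) : ℝ) + m + 1) * ∫ x, h x ∂π + 2 * b / δ))))
      fun ω => ?_).trans (by simp)
    refine ENNReal.ofReal_le_ofReal (Real.exp_le_exp.2 ?_)
    have := abs_le.1 ((abs_valueFun_sub_le hπ hδ hκ hh hb hδ1 m).2 (S 0 ω))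
    simp only [Nat.cast_zero, Finset.range_zero, Finset.sum_empty, zero_mul, zero_add]
    exact mul_le_mul_of_nonneg_left (by linarith) ht
  | succ l ih =>
    have hu := measurable_valueFun κ hh m
    have hG : Measurable fun p : Fin (l + 1) → E =>
        ENNReal.ofReal (Real.exp (t * ∑ j, h (p j))) :=
      ENNReal.measurable_ofReal.comp <| Real.measurable_exp.comp <| measurable_const.mul <|
        Finset.measurable_sum _ fun j _ => hh.comp (measurable_pi_apply j)
    have hφ : Measurable fun z => ENNReal.ofReal (Real.exp (t * valueFun κ h m z)) := by fun_prop
    have key := lintegral_mul_of_markov κ hS (hP l) hG hφ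
    have h1 : ∀ ω, ENNReal.ofReal (Real.exp (t * (∑ j ∈ Finset.range (l + 1), h (S j ω) +
        valueFun κ h m (S (l + 1) ω)))) =
        ENNReal.ofReal (Real.exp (t * ∑ j : Fin (l + 1), h (S j ω))) *
          ENNReal.ofReal (Real.exp (t * valueFun κ h m (S (l + 1) ω))) := fun ω => by
      rw [← ENNReal.ofReal_mul (Real.exp_nonneg _), ← Real.exp_add, Finset.sum_range, mul_add]
    simp_rw [h1]
    rw [key]
    have h2 : ∀ ω, ENNReal.ofReal (Real.exp (t * ∑ j : Fin (l + 1), h (S j ω))) *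
        ∫⁻ z, ENNReal.ofReal (Real.exp (t * valueFun κ h m z)) ∂κ (S l ω) ≤
        ENNReal.ofReal (Real.exp ((2 * b / δ) ^ 2 * t ^ 2 / 2)) *
        ENNReal.ofReal (Real.exp (t * (∑ j ∈ Finset.range l, h (S j ω) +
          valueFun κ h (m + 1) (S l ω)))) := fun ω => by
      refine (mul_le_mul_right (lintegral_exp_le_of_abs_sub_le hu
        (abs_valueFun_sub_le hπ hδ hκ hh hb hδ1 m).2 t) _).trans_eq ?_
      rw [← ENNReal.ofReal_mul (Real.exp_nonneg _), ← ENNReal.ofReal_mul (Real.exp_nonneg _),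
        ← Real.exp_add, ← Real.exp_add, ← Real.exp_add, ← Finset.sum_range (fun j => h (S j ω)),
        Finset.sum_range_succ, valueFun]
      ring_nf
    refine (lintegral_mono h2).trans ?_
    rw [lintegral_const_mul' _ _ ENNReal.ofReal_ne_top]
    refine (mul_le_mul_right (ih (m + 1)) _).trans_eq ?_
    rw [← ENNReal.ofReal_mul (Real.exp_nonneg _), ← Real.exp_add]
    push_cast
    ring_nf

/-- One-sided deviation inequality for the additive functional of a uniformly ergodic Markov
chain. -/
lemma measureReal_sum_ge_le {κ : Kernel E E} [IsMarkovKernel κ] {π : Measure E}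
    [IsProbabilityMeasure π] (hπ : κ.Invariant π) {δ : ℝ≥0} (hδ : 0 < δ) (hδ1 : δ ≤ 1)
    (hκ : ∀ x, δ • π ≤ κ x) {h : E → ℝ} (hh : Measurable h) {b : ℝ} (hb : ∀ x, |h x| ≤ b)
    {Ω : Type*} [MeasurableSpace Ω] {P : Measure Ω} [IsProbabilityMeasure P]
    {S : ℕ → Ω → E} (hS : ∀ l, Measurable (S l))
    (hP : ∀ (l : ℕ) (A : Set (Fin (l + 1) → E)) (B : Set E), MeasurableSet A → MeasurableSet B →
      P {ω | (fun i : Fin (l + 1) => S i ω) ∈ A ∧ S (l + 1) ω ∈ B} =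
        ∫⁻ ω in {ω | (fun i : Fin (l + 1) => S i ω) ∈ A}, κ (S l ω) B ∂P)
    {t : ℝ} (ht : 0 ≤ t) (m : ℕ) (a : ℝ) :
    P.real {ω | a ≤ ∑ l ∈ Finset.range (m + 1), h (S l ω) - (m + 1) * ∫ z, h z ∂π} ≤
      Real.exp (m * ((2 * b / δ) ^ 2 * t ^ 2 / 2) + t * (2 * b / δ) - t * a) := by
  have h1 := lintegral_exp_sum_le hπ hδ hδ1 hκ hh hb hS hP ht 0 m
  have hmeas : Measurable fun ω => ENNReal.ofReal (Real.exp (t * (∑ j ∈ Finset.range m, h (S j ω) +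
      valueFun κ h 0 (S m ω)))) :=
    ENNReal.measurable_ofReal.comp <| Real.measurable_exp.comp <| measurable_const.mul <|
      (Finset.measurable_sum _ fun j _ => hh.comp (hS j)).add (hh.comp (hS m))
  set e := t * (a + (m + 1) * ∫ z, h z ∂π) with he
  have h2 := mul_meas_ge_le_lintegral (μ := P) hmeas (ENNReal.ofReal (Real.exp e))
  have h3 : ENNReal.ofReal (Real.exp e) *
      P {ω | a ≤ ∑ l ∈ Finset.range (m + 1), h (S l ω) - (m + 1) * ∫ z, h z ∂π} ≤
      ENNReal.ofReal (Real.exp (m * ((2 * b / δ) ^ 2 * t ^ 2 / 2) +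
        t * ((m + (0 : ℕ) + 1) * ∫ x, h x ∂π + 2 * b / δ))) := by
    refine (mul_le_mul_right (measure_mono fun ω hω => ?_) _).trans (h2.trans h1)
    refine ENNReal.ofReal_le_ofReal (Real.exp_le_exp.2 (mul_le_mul_of_nonneg_left ?_ ht))
    have : a ≤ ∑ l ∈ Finset.range (m + 1), h (S l ω) - (m + 1) * ∫ z, h z ∂π := hω
    rw [Finset.sum_range_succ] at this
    simp only [valueFun]
    linarith
  have h4 := ENNReal.toReal_mono ENNReal.ofReal_ne_top h3
  rw [ENNReal.toReal_mul, ENNReal.toReal_ofReal (Real.exp_nonneg _),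
    ENNReal.toReal_ofReal (Real.exp_nonneg _), mul_comm, ← le_div_iff₀ (Real.exp_pos _),
    ← Real.exp_sub] at h4
  refine h4.trans_eq ?_
  rw [he]
  push_cast
  ring_nf

/-- Deviation inequality for the averages along a uniformly ergodic Markov chain. -/
lemma measureReal_abs_average_sub_ge_le {κ : Kernel E E} [IsMarkovKernel κ] {π : Measure E}
    [IsProbabilityMeasure π] (hπ : κ.Invariant π) {δ : ℝ≥0} (hδ : 0 < δ) (hδ1 : δ ≤ 1)
    (hκ : ∀ x, δ • π ≤ κ x) {h : E → ℝ} (hh : Measurable h) {b : ℝ} (hb : ∀ x, |h x| ≤ b)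
    {Ω : Type*} [MeasurableSpace Ω] {P : Measure Ω} [IsProbabilityMeasure P]
    {S : ℕ → Ω → E} (hS : ∀ l, Measurable (S l))
    (hP : ∀ (l : ℕ) (A : Set (Fin (l + 1) → E)) (B : Set E), MeasurableSet A → MeasurableSet B →
      P {ω | (fun i : Fin (l + 1) => S i ω) ∈ A ∧ S (l + 1) ω ∈ B} =
        ∫⁻ ω in {ω | (fun i : Fin (l + 1) => S i ω) ∈ A}, κ (S l ω) B ∂P)
    {m : ℕ} (hm : 1 ≤ m) {ε : ℝ} (hε : 0 < ε) :
    P.real {ω | ε ≤ |(1 / (m : ℝ)) * ∑ l ∈ Finset.range (m + 1), h (S l ω) - ∫ z, h z ∂π|} ≤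
      2 * Real.exp 3 * Real.exp (-(m * (δ ^ 2 / 8) * (ε ^ 2 / b ^ 2))) := by
  obtain ⟨x₀⟩ : Nonempty E := nonempty_of_isProbabilityMeasure π
  have hb0 : 0 ≤ b := (abs_nonneg _).trans (hb x₀)
  have hm1 : (1 : ℝ) ≤ m := by exact_mod_cast hm
  have hm0 : (0 : ℝ) < m := by linarith
  have hδ' : (0 : ℝ) < δ := hδ
  have hδ1' : (δ : ℝ) ≤ 1 := hδ1
  have hmean : |∫ x, h x ∂π| ≤ b := by
    simpa using norm_integral_le_of_norm_le_const (μ := π) (f := h) (ae_of_all _ hb)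
  have hdiv : ∀ ω, (1 / (m : ℝ)) * ∑ l ∈ Finset.range (m + 1), h (S l ω) - ∫ z, h z ∂π =
      (∑ l ∈ Finset.range (m + 1), h (S l ω) - m * ∫ z, h z ∂π) / m := fun ω => by
    field_simp
  have hset : {ω | ε ≤ |(1 / (m : ℝ)) * ∑ l ∈ Finset.range (m + 1), h (S l ω) - ∫ z, h z ∂π|} =
      {ω | m * ε ≤ |∑ l ∈ Finset.range (m + 1), h (S l ω) - m * ∫ z, h z ∂π|} := by
    ext ω
    simp only [Set.mem_ofPred_eq]
    rw [hdiv, abs_div, abs_of_pos hm0, le_div_iff₀ hm0, mul_comm]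
  rw [hset]
  have hsum : ∀ ω, |∑ l ∈ Finset.range (m + 1), h (S l ω)| ≤ (m + 1) * b := fun ω => by
    refine (Finset.abs_sum_le_sum_abs _ _).trans ((Finset.sum_le_sum fun l _ => hb _).trans_eq ?_)
    simp
  rcases lt_or_ge (3 * b) ε with hlarge | hsmall
  · have : {ω | m * ε ≤ |∑ l ∈ Finset.range (m + 1), h (S l ω) - m * ∫ z, h z ∂π|} = ∅ := by
      refine Set.eq_empty_of_forall_notMem fun ω hω => ?_
      have h1 : m * ε ≤ |∑ l ∈ Finset.range (m + 1), h (S l ω) - m * ∫ z, h z ∂π| := hω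
      have h2 := abs_sub (∑ l ∈ Finset.range (m + 1), h (S l ω)) (m * ∫ z, h z ∂π)
      rw [abs_mul, abs_of_pos hm0] at h2
      have h3 := mul_le_mul_of_nonneg_left hmean hm0.le
      have h4 := mul_lt_mul_of_pos_left hlarge hm0
      nlinarith [hsum ω, mul_nonneg (sub_nonneg.2 hm1) hb0]
    rw [this]
    simp only [measureReal_empty]
    positivity
  · have hbpos : 0 < b := by linarith
    set D := 2 * b / (δ : ℝ) with hD
    have hDpos : 0 < D := by positivity
    have hDb : 2 * b ≤ D := by
      rw [hD, le_div_iff₀ hδ']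
      nlinarith
    have hneg : ∫ z, (fun z => - h z) z ∂π = - ∫ z, h z ∂π := integral_neg _
    have hup := measureReal_sum_ge_le hπ hδ hδ1 hκ hh hb hS hP (t := ε / D ^ 2) (by positivity)
      m (m * ε - D)
    have hdown := measureReal_sum_ge_le hπ hδ hδ1 hκ (h := fun z => - h z) hh.neg
      (b := b) (by simpa using hb) hS hP (t := ε / D ^ 2) (by positivity) m (m * ε - D)
    rw [hneg] at hdown
    have hexp : Real.exp (m * (D ^ 2 * (ε / D ^ 2) ^ 2 / 2) + ε / D ^ 2 * D -
        ε / D ^ 2 * (m * ε - D)) ≤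
        Real.exp 3 * Real.exp (-(m * ((δ : ℝ) ^ 2 / 8) * (ε ^ 2 / b ^ 2))) := by
      rw [← Real.exp_add]
      refine Real.exp_le_exp.2 ?_
      have h1 : m * (D ^ 2 * (ε / D ^ 2) ^ 2 / 2) + ε / D ^ 2 * D - ε / D ^ 2 * (m * ε - D) =
          2 * (ε / D) - m * (ε ^ 2 / D ^ 2) / 2 := by
        field_simp
        ring
      have h2 : m * ((δ : ℝ) ^ 2 / 8) * (ε ^ 2 / b ^ 2) = m * (ε ^ 2 / D ^ 2) / 2 := by
        rw [hD]
        field_simp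
        ring
      have h3 : ε / D ≤ 3 / 2 := by
        rw [div_le_iff₀ hDpos]
        linarith
      rw [h1, h2]
      linarith
    have hsub : {ω | m * ε ≤ |∑ l ∈ Finset.range (m + 1), h (S l ω) - m * ∫ z, h z ∂π|} ⊆
        {ω | m * ε - D ≤ ∑ l ∈ Finset.range (m + 1), h (S l ω) - (m + 1) * ∫ z, h z ∂π} ∪
        {ω | m * ε - D ≤ ∑ l ∈ Finset.range (m + 1), (fun z => - h z) (S l ω) -
          (m + 1) * -∫ z, h z ∂π} := fun ω hω => by
      have h1 : m * ε ≤ |∑ l ∈ Finset.range (m + 1), h (S l ω) - m * ∫ z, h z ∂π| := hω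
      have h2 := abs_le.1 hmean
      rcases le_abs.1 h1 with h3 | h3
      · left
        simp only [Set.mem_ofPred_eq]
        linarith
      · right
        simp only [Set.mem_ofPred_eq, Finset.sum_neg_distrib]
        linarith
    calc _ ≤ _ := measureReal_mono hsub
      _ ≤ _ := measureReal_union_le _ _
      _ ≤ _ := add_le_add (hup.trans hexp) (hdown.trans hexp)
      _ = _ := by ring

end UniformlyErgodic

section IndependentMetropolisHastings

open ProbabilityTheory

/-- The acceptance probability of the independent Metropolis-Hastings algorithm with importance
weight function `w`. -/
noncomputable def imhAccept {E : Type*} (w : E → ℝ≥0∞) (p p' : E) : ℝ≥0∞ := min 1 (w p' / w p)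

lemma imhAccept_le_one {E : Type*} (w : E → ℝ≥0∞) (p p' : E) : imhAccept w p p' ≤ 1 := min_le_left _ _

lemma mul_imhAccept {E : Type*} {w : E → ℝ≥0∞} {p : E} (hp : w p ≠ ∞) (p' : E) : w p * imhAccept w p p' = min (w p) (w p') := by
  rw [imhAccept, mul_min, mul_one]
  rcases eq_or_ne (w p) 0 with h0 | h0
  · simp [h0]
  · rw [ENNReal.mul_div_cancel h0 hp]

variable {E : Type*} [MeasurableSpace E]

lemma measurable_uncurry_imhAccept {w : E → ℝ≥0∞} (hw : Measurable w) :
    Measurable (Function.uncurry (imhAccept w)) :=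
  measurable_const.min ((hw.comp measurable_snd).div (hw.comp measurable_fst))

lemma measurable_imhAccept {w : E → ℝ≥0∞} (hw : Measurable w) (p : E) :
    Measurable (imhAccept w p) :=
  measurable_const.min (hw.div measurable_const)

/-- The transition kernel of the independent Metropolis-Hastings algorithm with proposal
distribution `Q` and importance weight function `w`. -/
noncomputable def imhKernel (Q : Measure E) [SFinite Q] {w : E → ℝ≥0∞} (hw : Measurable w) :
    Kernel E E where
  toFun p := Q.withDensity (imhAccept w p) +
    (∫⁻ p', (1 - imhAccept w p p') ∂Q) • Measure.dirac p
  measurable' := by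
    have hα := measurable_uncurry_imhAccept hw
    refine Measure.measurable_of_measurable_coe _ fun A hA => ?_
    simp only [Measure.add_apply, Measure.smul_apply, smul_eq_mul, withDensity_apply _ hA,
      Measure.dirac_apply' _ hA]
    refine Measurable.add ?_ (Measurable.mul ?_ (measurable_one.indicator hA))
    · exact hα.lintegral_prod_right'
    · exact (hα.const_sub 1).lintegral_prod_right'

variable {Q : Measure E} {w : E → ℝ≥0∞}

lemma imhKernel_apply [SFinite Q] (hw : Measurable w) (p : E) {A : Set E} (hA : MeasurableSet A) :
    imhKernel Q hw p A = ∫⁻ p', (imhAccept w p p' * A.indicator 1 p' +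
      (1 - imhAccept w p p') * A.indicator 1 p) ∂Q := by
  have hα := measurable_imhAccept hw p
  have hαA : Measurable fun p' => imhAccept w p p' * A.indicator 1 p' :=
    hα.mul (measurable_one.indicator hA)
  rw [lintegral_add_left hαA,
    lintegral_mul_const _ (hα.const_sub 1)]
  change (Q.withDensity (imhAccept w p) +
    (∫⁻ p', (1 - imhAccept w p p') ∂Q) • Measure.dirac p) A = _
  rw [Measure.add_apply, Measure.smul_apply, smul_eq_mul, withDensity_apply _ hA,
    Measure.dirac_apply' _ hA, ← lintegral_indicator hA]
  congr 2
  ext p'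
  by_cases h : p' ∈ A <;> simp [h]

instance isMarkovKernel_imhKernel [IsProbabilityMeasure Q] (hw : Measurable w) :
    IsMarkovKernel (imhKernel Q hw) where
  isProbabilityMeasure p := ⟨by
    rw [imhKernel_apply hw p MeasurableSet.univ]
    simp [add_tsub_cancel_of_le (imhAccept_le_one w p _)]⟩

lemma lintegral_mul_imhKernel [SFinite Q] (hw : Measurable w) (hfin : ∀ p, w p ≠ ∞)
    (hQ : Q Set.univ = 1) {A : Set E} (hA : MeasurableSet A) :
    ∫⁻ p, w p * imhKernel Q hw p A ∂Q = ∫⁻ p, w p * A.indicator 1 p ∂Q := by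
  have hα := measurable_uncurry_imhAccept hw
  have hA1 : Measurable (A.indicator (1 : E → ℝ≥0∞)) := measurable_one.indicator hA
  have hm : Measurable fun q : E × E => min (w q.1) (w q.2) :=
    (hw.comp measurable_fst).min (hw.comp measurable_snd)
  have hm1 : Measurable fun q : E × E => min (w q.1) (w q.2) * A.indicator 1 q.1 :=
    hm.mul (hA1.comp measurable_fst)
  have hm2 : Measurable fun q : E × E => min (w q.1) (w q.2) * A.indicator 1 q.2 :=
    hm.mul (hA1.comp measurable_snd)
  have hsplit : ∀ p, w p * imhKernel Q hw p A =
      ∫⁻ p', min (w p) (w p') * A.indicator 1 p' ∂Q +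
        ∫⁻ p', w p * (1 - imhAccept w p p') * A.indicator 1 p ∂Q := fun p => by
    rw [imhKernel_apply hw p hA, ← lintegral_const_mul' _ _ (hfin p)]
    refine Eq.trans (lintegral_congr fun p' => ?_)
      (lintegral_add_left (hm2.comp (measurable_prodMk_left (x := p))) _)
    simp only [mul_add, ← mul_assoc, mul_imhAccept (hfin p), Function.comp_apply]
  have hswap : ∫⁻ p, ∫⁻ p', min (w p) (w p') * A.indicator 1 p' ∂Q ∂Q =
      ∫⁻ p, ∫⁻ p', min (w p) (w p') * A.indicator 1 p ∂Q ∂Q := by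
    rw [lintegral_lintegral_swap hm2.aemeasurable]
    simp_rw [min_comm]
  simp_rw [hsplit]
  rw [lintegral_add_left (Measurable.lintegral_prod_right' hm2), hswap,
    ← lintegral_add_left (Measurable.lintegral_prod_right' hm1)]
  refine lintegral_congr fun p => ?_
  refine (lintegral_add_left (hm1.comp (measurable_prodMk_left (x := p))) _).symm.trans ?_
  have : ∀ p', min (w p) (w p') * A.indicator 1 p +
      w p * (1 - imhAccept w p p') * A.indicator 1 p = w p * A.indicator 1 p := fun p' => by
    rw [← mul_imhAccept (hfin p), ← add_mul, ← mul_add,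
      add_tsub_cancel_of_le (imhAccept_le_one w p p'), mul_one]
  simp_rw [Function.comp_apply, this, lintegral_const, hQ, mul_one]

/-- The target distribution of the independent Metropolis-Hastings algorithm. -/
noncomputable def imhTarget (Q : Measure E) (w : E → ℝ≥0∞) : Measure E :=
  (∫⁻ p, w p ∂Q)⁻¹ • Q.withDensity w

lemma isProbabilityMeasure_imhTarget (h0 : ∫⁻ p, w p ∂Q ≠ 0) (hfin : ∫⁻ p, w p ∂Q ≠ ∞) :
    IsProbabilityMeasure (imhTarget Q w) :=
  ⟨by simp [imhTarget, ENNReal.inv_mul_cancel h0 hfin]⟩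

lemma invariant_imhKernel [IsProbabilityMeasure Q] (hw : Measurable w) (hfin : ∀ p, w p ≠ ∞) :
    (imhKernel Q hw).Invariant (imhTarget Q w) := by
  ext A hA
  rw [Measure.bind_apply hA (Kernel.measurable _).aemeasurable, imhTarget, lintegral_smul_measure,
    lintegral_withDensity_eq_lintegral_mul _ hw (Kernel.measurable_coe _ hA),
    Measure.smul_apply, withDensity_apply _ hA, ← lintegral_indicator hA]
  congr 1
  refine (lintegral_mul_imhKernel hw hfin measure_univ hA).trans (lintegral_congr fun p => ?_)
  by_cases h : p ∈ A <;> simp [h]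

lemma smul_imhTarget_le_imhKernel [SFinite Q] (hw : Measurable w)
    {B : ℝ≥0∞} (hB0 : B ≠ 0) (hB : ∀ p, w p ≤ B) (hBfin : B ≠ ∞) {δ : ℝ≥0}
    (hδ : δ * B ≤ ∫⁻ p, w p ∂Q) (h0 : ∫⁻ p, w p ∂Q ≠ 0) (hfin : ∫⁻ p, w p ∂Q ≠ ∞) (p : E) :
    δ • imhTarget Q w ≤ imhKernel Q hw p := by
  have hcoef : δ * (∫⁻ p, w p ∂Q)⁻¹ ≤ B⁻¹ := by
    rw [← div_eq_mul_inv, ENNReal.div_le_iff h0 hfin, mul_comm, ← div_eq_mul_inv]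
    exact ENNReal.le_div_iff_mul_le (Or.inl hB0) (Or.inl hBfin) |>.2 hδ
  refine Measure.le_iff.2 fun A hA => ?_
  change _ ≤ (Q.withDensity (imhAccept w p) +
    (∫⁻ p', (1 - imhAccept w p p') ∂Q) • Measure.dirac p) A
  refine le_trans ?_ (Measure.le_add_right le_rfl A)
  rw [imhTarget, Measure.smul_apply, Measure.smul_apply, withDensity_apply _ hA,
    withDensity_apply _ hA, ENNReal.smul_def, smul_eq_mul, smul_eq_mul, ← mul_assoc]
  refine (mul_le_mul_left hcoef _).trans ?_
  rw [← lintegral_const_mul _ hw]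
  refine lintegral_mono fun p' => ?_
  rw [mul_comm, ← div_eq_mul_inv]
  exact le_min (ENNReal.div_le_of_le_mul (by simpa using hB p'))
    (ENNReal.div_le_div_left (hB p) _)

end IndependentMetropolisHastings

section ProductMeasures

variable {α : Type*} [MeasurableSpace α]

/-- Integration over a finite product, the last coordinate first. -/
lemma lintegral_pi_snoc {n : ℕ} (μ : Fin (n + 1) → Measure α) [∀ i, SigmaFinite (μ i)]
    {f : (Fin (n + 1) → α) → ℝ≥0∞} (hf : Measurable f) :
    ∫⁻ x, f x ∂Measure.pi μ =
      ∫⁻ x, ∫⁻ z, f (Fin.snoc (α := fun _ => α) x z) ∂μ (Fin.last n)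
        ∂Measure.pi (fun i : Fin n => μ i.castSucc) := by
  have h := (measurePreserving_piFinSuccAbove μ (Fin.last n)).symm
  have hf' := hf.comp h.measurable
  rw [← h.lintegral_comp hf]
  refine (lintegral_prod_symm _ hf'.aemeasurable).trans ?_
  simp [MeasurableEquiv.piFinSuccAbove_symm_apply, Fin.insertNthEquiv]

lemma measurable_snoc {n : ℕ} : Measurable fun p : (Fin n → α) × α =>
    (Fin.snoc (α := fun _ => α) p.1 p.2 : Fin (n + 1) → α) := by
  refine measurable_pi_lambda _ fun i => ?_
  induction i using Fin.lastCases with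
  | last => simpa using measurable_snd
  | cast i =>
    simp only [Fin.snoc_castSucc]
    fun_prop

lemma lintegral_pi_prod {n : ℕ} (μ : Measure α) [SigmaFinite μ] {f : Fin n → α → ℝ≥0∞}
    (hf : ∀ i, Measurable (f i)) :
    ∫⁻ x, ∏ i, f i (x i) ∂Measure.pi (fun _ : Fin n => μ) = ∏ i, ∫⁻ z, f i z ∂μ := by
  induction n with
  | zero => simp
  | succ n ih =>
    rw [lintegral_pi_snoc _ (by fun_prop)]
    simp_rw [Fin.prod_univ_castSucc, Fin.snoc_castSucc, Fin.snoc_last]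
    simp_rw [lintegral_const_mul _ (hf (Fin.last n))]
    rw [lintegral_mul_const _ (by fun_prop), ih fun i => hf i.castSucc]

lemma sum_fun_snoc {β M : Type*} [Fintype β] [AddCommMonoid M] {n : ℕ}
    (f : (Fin (n + 1) → β) → M) :
    ∑ a, f a = ∑ a : Fin n → β, ∑ b, f (Fin.snoc (α := fun _ => β) a b) := by
  rw [Finset.sum_comm, ← Fintype.sum_prod_type',
    ← (Fin.snocEquiv (fun _ : Fin (n + 1) => β)).sum_comp]
  rfl

/-- Independent draws from a law on pairs consisting of an index and a point: the expectation of a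
function of one of the draws. -/
lemma lintegral_pi_sum_prod_mul {N : ℕ} (μ : Measure α) [SigmaFinite μ]
    {φ H : Fin N → α → ℝ≥0∞} (hφ : ∀ i, Measurable (φ i)) (hH : ∀ i, Measurable (H i))
    (h1 : ∑ i, ∫⁻ z, φ i z ∂μ = 1) (j : Fin N) :
    ∫⁻ x, ∑ a : Fin N → Fin N, (∏ l, φ (a l) (x l)) * H (a j) (x j)
      ∂Measure.pi (fun _ : Fin N => μ) = ∑ i, ∫⁻ z, φ i z * H i z ∂μ := by
  have hψ : ∀ l : Fin N, ∀ i, Measurable fun z => φ i z * if l = j then H i z else 1 :=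
    fun l i => by
      split_ifs
      · exact (hφ i).mul (hH i)
      · exact (hφ i).mul measurable_const
  have hprod : ∀ (a : Fin N → Fin N) (x : Fin N → α), (∏ l, φ (a l) (x l)) * H (a j) (x j) =
      ∏ l, (φ (a l) (x l) * if l = j then H (a l) (x l) else 1) := fun a x => by
    rw [Finset.prod_mul_distrib]
    simp
  simp_rw [hprod]
  have hsum : ∀ x : Fin N → α,
      ∑ a : Fin N → Fin N, ∏ l, (φ (a l) (x l) * if l = j then H (a l) (x l) else 1) =
      ∏ l, ∑ i, (φ i (x l) * if l = j then H i (x l) else 1) := fun x =>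
    (Fintype.prod_sum fun l i => φ i (x l) * if l = j then H i (x l) else 1).symm
  simp_rw [hsum]
  rw [lintegral_pi_prod μ (f := fun l z => ∑ i, (φ i z * if l = j then H i z else 1))
    fun l => Finset.measurable_sum _ fun i _ => hψ l i,
    ← Finset.mul_prod_erase _ _ (Finset.mem_univ j), Finset.prod_eq_one, mul_one,
    lintegral_finsetSum _ fun i _ => hψ j i]
  · simp
  · intro l hl
    rw [lintegral_finsetSum _ fun i _ => hψ l i]
    simpa [Finset.ne_of_mem_erase hl] using h1

end ProductMeasures

section NormalizedWeights

variable {N : ℕ}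

lemma sum_normalizedWeight (hN : 1 ≤ N) {w : Fin N → ℝ≥0∞} (hw : ∀ i, w i ≠ ∞) :
    ∑ i, normalizedWeight w i = 1 := by
  have hN' : (N : ℝ≥0∞) ≠ 0 := by exact_mod_cast (by omega : N ≠ 0)
  unfold normalizedWeight
  split_ifs with h
  · simp [ENNReal.mul_inv_cancel hN']
  · simp_rw [div_eq_mul_inv]
    rw [← Finset.sum_mul, ENNReal.mul_inv_cancel h (by simpa using hw)]

lemma sum_mul_normalizedWeight {w : Fin N → ℝ≥0∞} (hw : ∀ i, w i ≠ ∞) (i : Fin N) :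
    (∑ l, w l) * normalizedWeight w i = w i := by
  unfold normalizedWeight
  split_ifs with h
  · rw [h, zero_mul]
    exact ((Finset.sum_eq_zero_iff.1 h) i (Finset.mem_univ i)).symm
  · exact ENNReal.mul_div_cancel h (by simpa using hw)

lemma measurable_normalizedWeight {α : Type*} [MeasurableSpace α] {w : α → Fin N → ℝ≥0∞}
    (hw : ∀ i, Measurable fun a => w a i) (i : Fin N) :
    Measurable fun a => normalizedWeight (w a) i := by
  have hs : Measurable fun a => ∑ l, w a l := Finset.measurable_sum _ fun l _ => hw l
  unfold normalizedWeight
  exact Measurable.ite (hs (measurableSet_singleton 0)) measurable_const ((hw i).div hs)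

end NormalizedWeights

namespace StateSpaceModel

variable {X Y : Type*} [MeasurableSpace X] [MeasurableSpace Y] (M : StateSpaceModel X Y)

instance : SigmaFinite M.refX := M.sigmaFinite_refX

instance : IsProbabilityMeasure M.init := M.isProbabilityMeasure_init

instance (p : Prop) [Decidable p] : SigmaFinite (if p then M.init else M.refX) := by
  split_ifs <;> infer_instance

variable {n : ℕ}

/-- The unnormalised smoothing density with respect to the product of the reference measures. -/
noncomputable def jointDensity (y : Fin (n + 1) → Y) (x : Trajectory X n) : ℝ≥0∞ :=
  (∏ k : Fin (n + 1), (M.g (x k) (y k) : ℝ≥0∞)) *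
    ∏ k : Fin n, (M.q (x k.castSucc) (x k.succ) : ℝ≥0∞)

lemma measurable_g_left (y : Y) : Measurable fun x => (M.g x y : ℝ≥0∞) :=
  (M.measurable_g.comp (measurable_id.prodMk measurable_const)).coe_nnreal_ennreal

lemma measurable_q_comp {α : Type*} [MeasurableSpace α] {u v : α → X} (hu : Measurable u)
    (hv : Measurable v) : Measurable fun a => (M.q (u a) (v a) : ℝ≥0∞) :=
  (M.measurable_q.comp (hu.prodMk hv)).coe_nnreal_ennreal

lemma measurable_jointDensity (y : Fin (n + 1) → Y) : Measurable (M.jointDensity y) :=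
  (Finset.measurable_prod _ fun k _ =>
    (M.measurable_g_left (y k)).comp (measurable_pi_apply k)).mul <|
  Finset.measurable_prod _ fun k _ =>
    M.measurable_q_comp (measurable_pi_apply k.castSucc) (measurable_pi_apply k.succ)

lemma measurable_jointDensity_mul (y : Fin (n + 1) → Y) {f : Trajectory X n → ℝ≥0∞}
    (hf : Measurable f) : Measurable fun x => M.jointDensity y x * f x :=
  (M.measurable_jointDensity y).mul hf

lemma lintegral_jointMeasure (y : Fin (n + 1) → Y) {f : Trajectory X n → ℝ≥0∞}
    (hf : Measurable f) :
    ∫⁻ x, f x ∂M.jointMeasure y = ∫⁻ x, M.jointDensity y x * f x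
      ∂Measure.pi (fun k : Fin (n + 1) => if k = 0 then M.init else M.refX) :=
  lintegral_withDensity_eq_lintegral_mul _ (M.measurable_jointDensity y) hf

lemma lintegral_jointMeasure_zero (y : Fin 1 → Y) {f : Trajectory X 0 → ℝ≥0∞}
    (hf : Measurable f) :
    ∫⁻ x, f x ∂M.jointMeasure y = ∫⁻ z, (M.g z (y 0) : ℝ≥0∞) * f (fun _ => z) ∂M.init := by
  rw [lintegral_jointMeasure M y hf, lintegral_pi_snoc _ (M.measurable_jointDensity_mul y hf)]
  have : ∀ (u : Fin 0 → X) (z : X),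
      (Fin.snoc (α := fun _ => X) u z : Fin 1 → X) = fun _ => z := fun u z => by
    ext i
    rw [show i = Fin.last 0 from Fin.eq_zero i, Fin.snoc_last]
  simp [this, jointDensity]

/-- One step of the forward smoothing recursion. -/
noncomputable def extend (y : Y) (f : Trajectory X (n + 1) → ℝ≥0∞) (x : Trajectory X n) : ℝ≥0∞ :=
  ∫⁻ z, (M.g z y : ℝ≥0∞) * M.q (x (Fin.last n)) z * f (Fin.snoc (α := fun _ => X) x z) ∂M.refX

lemma measurable_extend_integrand (y : Y) {f : Trajectory X (n + 1) → ℝ≥0∞} (hf : Measurable f) :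
    Measurable fun p : Trajectory X n × X => (M.g p.2 y : ℝ≥0∞) * M.q (p.1 (Fin.last n)) p.2 *
      f (Fin.snoc (α := fun _ => X) p.1 p.2) :=
  (((M.measurable_g_left y).comp measurable_snd).mul (M.measurable_q_comp
    ((measurable_pi_apply (Fin.last n)).comp measurable_fst) measurable_snd)).mul
      (hf.comp measurable_snoc)

lemma measurable_extend (y : Y) {f : Trajectory X (n + 1) → ℝ≥0∞} (hf : Measurable f) :
    Measurable (M.extend y f) :=
  (M.measurable_extend_integrand y hf).lintegral_prod_right'

lemma lintegral_jointMeasure_succ (y : Fin (n + 2) → Y) {f : Trajectory X (n + 1) → ℝ≥0∞}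
    (hf : Measurable f) :
    ∫⁻ x, f x ∂M.jointMeasure y = ∫⁻ x, M.extend (y (Fin.last (n + 1))) f x
      ∂M.jointMeasure (fun k : Fin (n + 1) => y k.castSucc) := by
  rw [lintegral_jointMeasure M y hf, lintegral_jointMeasure M _ (M.measurable_extend _ hf),
    lintegral_pi_snoc _ (M.measurable_jointDensity_mul y hf)]
  simp only [Fin.castSucc_eq_zero_iff, Fin.last_eq_zero_iff, Nat.add_eq_zero_iff, one_ne_zero,
    and_false, if_false]
  refine lintegral_congr fun x => ?_
  refine Eq.trans ?_ (lintegral_const_mul _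
    ((M.measurable_extend_integrand _ hf).comp (measurable_prodMk_left (x := x))))
  refine lintegral_congr fun z => ?_
  simp only [jointDensity]
  rw [Fin.prod_univ_castSucc (fun k : Fin (n + 2) =>
      (M.g (Fin.snoc (α := fun _ => X) x z k) (y k) : ℝ≥0∞)),
    Fin.prod_univ_castSucc (fun k : Fin (n + 1) =>
      (M.q (Fin.snoc (α := fun _ => X) x z k.castSucc)
        (Fin.snoc (α := fun _ => X) x z k.succ) : ℝ≥0∞))]
  simp only [Fin.snoc_castSucc, Fin.snoc_last, Fin.succ_castSucc, Fin.succ_last]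
  ring

end StateSpaceModel

namespace AuxiliaryParticleFilter

section SnocSystem

variable {X : Type*} {n N : ℕ}

/-- Add a generation of particles and their ancestor indices to a particle system. -/
def snocSystem (s : ParticleSystem X n N) (x : Fin N → X) (a : Fin N → Fin N) :
    ParticleSystem X (n + 1) N :=
  (Fin.snoc (α := fun _ => Fin N → X) s.1 x, Fin.snoc (α := fun _ => Fin N → Fin N) s.2 a)

variable (s : ParticleSystem X n N) (x : Fin N → X) (a : Fin N → Fin N)

lemma snocSystem_fst_castSucc (k : Fin (n + 1)) : (snocSystem s x a).1 k.castSucc = s.1 k := by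
  simp [snocSystem]

lemma snocSystem_fst_last : (snocSystem s x a).1 (Fin.last (n + 1)) = x := by
  simp [snocSystem]

lemma snocSystem_snd_castSucc (k : Fin n) : (snocSystem s x a).2 k.castSucc = s.2 k := by
  simp [snocSystem]

lemma snocSystem_snd_last : (snocSystem s x a).2 (Fin.last n) = a := by
  simp [snocSystem]

lemma trajectory_snocSystem (j : Fin (n + 1) → Fin N) (i : Fin N) :
    (fun k => (snocSystem s x a).1 k (Fin.snoc (α := fun _ => Fin N) j i k)) =
      Fin.snoc (α := fun _ => X) (fun k => s.1 k (j k)) (x i) := by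
  ext k
  induction k using Fin.lastCases with
  | last => simp only [snocSystem_fst_last, Fin.snoc_last]
  | cast k => simp only [snocSystem_fst_castSucc, Fin.snoc_castSucc]

end SnocSystem

variable {X Y : Type*} [MeasurableSpace X] [MeasurableSpace Y] {M : StateSpaceModel X Y} {n : ℕ}

section Measurability

variable {N : ℕ}

lemma measurable_weightFunZero (F : AuxiliaryParticleFilter M n) (y : Fin (n + 1) → Y) :
    Measurable (F.weightFunZero y) :=
  (M.measurable_g_left (y 0)).mul F.measurable_initDens.coe_nnreal_ennreal

lemma measurable_adj_coe (F : AuxiliaryParticleFilter M n) (k : Fin n) :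
    Measurable fun x => (F.adj k x : ℝ≥0∞) :=
  (F.measurable_adj k).coe_nnreal_ennreal

lemma measurable_r_comp (F : AuxiliaryParticleFilter M n) (k : Fin n)
    {α : Type*} [MeasurableSpace α] {u v : α → X} (hu : Measurable u) (hv : Measurable v) :
    Measurable fun a => (F.r k (u a) (v a) : ℝ≥0∞) :=
  ((F.measurable_r k).comp (hu.prodMk hv)).coe_nnreal_ennreal

lemma measurable_weightFunSucc_comp (F : AuxiliaryParticleFilter M n) (y : Fin (n + 1) → Y)
    (k : Fin n) {α : Type*} [MeasurableSpace α] {u v : α → X} (hu : Measurable u)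
    (hv : Measurable v) : Measurable fun a => F.weightFunSucc y k (u a) (v a) :=
  (((M.measurable_g_left _).comp hv).mul (M.measurable_q_comp hu hv)).div
    (((F.measurable_adj_coe k).comp hu).mul (F.measurable_r_comp k hu hv))

lemma measurable_particle (k : Fin (n + 1)) (i : Fin N) :
    Measurable fun s : ParticleSystem X n N => s.1 k i :=
  (measurable_pi_apply i).comp ((measurable_pi_apply k).comp measurable_fst)

lemma measurable_apply_fin : Measurable fun p : (Fin N → X) × Fin N => p.1 p.2 :=
  measurable_from_prod_countable_left fun j => measurable_pi_apply j

lemma measurable_ancestor (k : Fin n) (i : Fin N) :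
    Measurable fun s : ParticleSystem X n N => s.2 k i :=
  (measurable_pi_apply i).comp ((measurable_pi_apply k).comp measurable_snd)

lemma measurable_weight (F : AuxiliaryParticleFilter M n) (y : Fin (n + 1) → Y) (k : Fin (n + 1))
    (i : Fin N) : Measurable fun s : ParticleSystem X n N => F.weight y s k i := by
  induction k using Fin.cases with
  | zero => exact (F.measurable_weightFunZero y).comp (measurable_particle 0 i)
  | succ l =>
    refine F.measurable_weightFunSucc_comp y l ?_ (measurable_particle l.succ i)
    exact measurable_apply_fin.comp (((measurable_pi_apply l.castSucc).comp measurable_fst).prodMk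
      (measurable_ancestor l i))

lemma measurable_weight_mul_adj (F : AuxiliaryParticleFilter M n) (y : Fin (n + 1) → Y)
    (k : Fin n) (i : Fin N) : Measurable fun s : ParticleSystem X n N =>
      F.weight y s k.castSucc i * F.adj k (s.1 k.castSucc i) :=
  (F.measurable_weight y _ i).mul ((F.measurable_adj_coe k).comp (measurable_particle _ i))

lemma measurable_likelihoodEstimate (F : AuxiliaryParticleFilter M n) (y : Fin (n + 1) → Y) :
    Measurable fun s : ParticleSystem X n N => F.likelihoodEstimate y s :=
  ((Finset.measurable_prod _ fun k _ => Finset.measurable_sum _ fun l _ =>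
    F.measurable_weight_mul_adj y k l).mul
      (Finset.measurable_sum _ fun l _ => F.measurable_weight y _ l)).div_const _

lemma measurable_auxProposal (F : AuxiliaryParticleFilter M n) (y : Fin (n + 1) → Y) (k : Fin n)
    (i : Fin N) : Measurable fun p : ParticleSystem X n N × X => F.auxProposal y p.1 k i p.2 := by
  have h1 : Measurable fun s : ParticleSystem X n N => normalizedWeight
      (fun l => F.weight y s k.castSucc l * F.adj k (s.1 k.castSucc l)) i :=
    measurable_normalizedWeight (fun l => F.measurable_weight_mul_adj y k l) i
  have h2 : Measurable fun p : ParticleSystem X n N × X =>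
      (F.r k (p.1.1 k.castSucc i) p.2 : ℝ≥0∞) :=
    F.measurable_r_comp k ((measurable_particle _ i).comp measurable_fst) measurable_snd
  exact (h1.comp measurable_fst).mul h2

/-- The density of the law of the particle filter. -/
noncomputable def filterDensity (F : AuxiliaryParticleFilter M n) (y : Fin (n + 1) → Y)
    (s : ParticleSystem X n N) : ℝ≥0∞ :=
  ∏ k : Fin n, ∏ l : Fin N, F.auxProposal y s k (s.2 k l) (s.1 k.succ l)

lemma measurable_filterDensity (F : AuxiliaryParticleFilter M n) (y : Fin (n + 1) → Y) :
    Measurable fun s : ParticleSystem X n N => F.filterDensity y s := by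
  unfold filterDensity
  refine Finset.measurable_prod _ fun k _ => Finset.measurable_prod _ fun l _ => ?_
  have h : Measurable fun p : (ParticleSystem X n N × X) × Fin N =>
      F.auxProposal y p.1.1 k p.2 p.1.2 :=
    measurable_from_prod_countable_left fun i => F.measurable_auxProposal y k i
  have hs : Measurable fun s : ParticleSystem X n N => ((s, s.1 k.succ l), s.2 k l) :=
    (measurable_id.prodMk (measurable_particle k.succ l)).prodMk (measurable_ancestor k l)
  simpa only [Function.comp_def] using h.comp hs

/-- The factor of the backward sampling probability of the indices `j` that comes from the times
before the last one. -/
noncomputable def backwardTail (F : AuxiliaryParticleFilter M n) (y : Fin (n + 1) → Y)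
    (s : ParticleSystem X n N) (j : Fin (n + 1) → Fin N) : ℝ≥0∞ :=
  ∏ k : Fin n, normalizedWeight
    (fun i => F.weight y s k.castSucc i * M.q (s.1 k.castSucc i) (s.1 k.succ (j k.succ)))
    (j k.castSucc)

lemma measurable_backwardTail (F : AuxiliaryParticleFilter M n) (y : Fin (n + 1) → Y)
    (j : Fin (n + 1) → Fin N) : Measurable fun s : ParticleSystem X n N => F.backwardTail y s j :=
  Finset.measurable_prod _ fun _ _ => measurable_normalizedWeight (fun i =>
    (F.measurable_weight y _ i).mul
      (M.measurable_q_comp (measurable_particle _ _) (measurable_particle _ _))) _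

lemma measurable_backwardProb (F : AuxiliaryParticleFilter M n) (y : Fin (n + 1) → Y)
    (j : Fin (n + 1) → Fin N) : Measurable fun s : ParticleSystem X n N => F.backwardProb y s j :=
  (measurable_normalizedWeight (fun l => F.measurable_weight y _ l) _).mul
    (F.measurable_backwardTail y j)

lemma measurable_trajectory (j : Fin (n + 1) → Fin N) :
    Measurable fun s : ParticleSystem X n N => fun k => s.1 k (j k) :=
  measurable_pi_lambda _ fun k => measurable_particle k (j k)

/-- The likelihood estimate without the contribution of the weights at the last time. -/
noncomputable def partialEstimate (F : AuxiliaryParticleFilter M n) (y : Fin (n + 1) → Y)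
    (s : ParticleSystem X n N) : ℝ≥0∞ :=
  (∏ k : Fin n, ∑ l : Fin N, F.weight y s k.castSucc l * F.adj k (s.1 k.castSucc l)) /
    (N : ℝ≥0∞) ^ (n + 1)

lemma measurable_partialEstimate (F : AuxiliaryParticleFilter M n) (y : Fin (n + 1) → Y) :
    Measurable fun s : ParticleSystem X n N => F.partialEstimate y s :=
  (Finset.measurable_prod _ fun k _ => Finset.measurable_sum _ fun l _ =>
    F.measurable_weight_mul_adj y k l).div_const _

end Measurability

section Bounds

variable {N : ℕ} {F : AuxiliaryParticleFilter M n} {y : Fin (n + 1) → Y}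

lemma BoundedWeights.weightFunSucc_ne_top (hF : F.BoundedWeights y) (k : Fin n) (x x' : X) :
    F.weightFunSucc y k x x' ≠ ∞ :=
  ((le_iSup₂ (f := fun x x' => F.weightFunSucc y k x x') x x').trans_lt
    (hF.weightFunSucc_bdd k)).ne

lemma BoundedWeights.exists_weight_le (hF : F.BoundedWeights y) (k : Fin (n + 1)) :
    ∃ C : ℝ≥0∞, C ≠ ∞ ∧ ∀ (s : ParticleSystem X n N) (i : Fin N), F.weight y s k i ≤ C := by
  induction k using Fin.cases with
  | zero => exact ⟨_, hF.weightFunZero_bdd.ne, fun s i => le_iSup (F.weightFunZero y) (s.1 0 i)⟩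
  | succ l =>
    exact ⟨_, (hF.weightFunSucc_bdd l).ne,
      fun s i => le_iSup₂ (f := fun x x' => F.weightFunSucc y l x x') _ _⟩

lemma BoundedWeights.weight_ne_top (hF : F.BoundedWeights y) (s : ParticleSystem X n N)
    (k : Fin (n + 1)) (i : Fin N) : F.weight y s k i ≠ ∞ := by
  obtain ⟨C, hC, h⟩ := hF.exists_weight_le (N := N) k
  exact ((h s i).trans_lt hC.lt_top).ne

lemma BoundedWeights.exists_likelihoodEstimate_le (hF : F.BoundedWeights y) (hN : 1 ≤ N) :
    ∃ B : ℝ≥0∞, B ≠ ∞ ∧ B ≠ 0 ∧ ∀ s : ParticleSystem X n N, F.likelihoodEstimate y s ≤ B := by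
  choose C hC h using fun k => hF.exists_weight_le (N := N) k
  refine ⟨(∏ k : Fin n, ∑ _l : Fin N, C k.castSucc * ⨆ x, (F.adj k x : ℝ≥0∞)) *
    (∑ _l : Fin N, C (Fin.last n)) / (N : ℝ≥0∞) ^ (n + 1) + 1, ?_, by simp, fun s => ?_⟩
  · refine ENNReal.add_ne_top.2 ⟨ENNReal.div_ne_top (ENNReal.mul_ne_top ?_ ?_) ?_,
      ENNReal.one_ne_top⟩
    · exact ENNReal.prod_ne_top fun k _ => ENNReal.sum_ne_top.2 fun _ _ =>
        ENNReal.mul_ne_top (hC _) (hF.adj_bdd k).ne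
    · exact ENNReal.sum_ne_top.2 fun _ _ => hC _
    · exact pow_ne_zero _ (by exact_mod_cast (by omega : N ≠ 0))
  · refine le_add_right (ENNReal.div_le_div_right (mul_le_mul' ?_ ?_) _)
    · exact Finset.prod_le_prod' fun k _ => Finset.sum_le_sum fun l _ =>
        mul_le_mul' (h _ s l) (le_iSup (fun x => (F.adj k x : ℝ≥0∞)) _)
    · exact Finset.sum_le_sum fun l _ => h _ s l

/-- The defining property of the importance weights. -/
lemma BoundedWeights.adj_mul_r_mul_weightFunSucc (hF : F.BoundedWeights y) (k : Fin n) (x x' : X) :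
    (F.adj k x : ℝ≥0∞) * F.r k x x' * F.weightFunSucc y k x x' =
      M.g x' (y k.succ) * M.q x x' := by
  have hfin := hF.weightFunSucc_ne_top k x x'
  unfold weightFunSucc at hfin ⊢
  rcases eq_or_ne ((F.adj k x : ℝ≥0∞) * F.r k x x') 0 with h0 | h0
  · rw [h0, zero_mul]
    by_contra hne
    exact hfin (by rw [h0, ENNReal.div_zero (Ne.symm hne)])
  · exact ENNReal.mul_div_cancel h0 (ENNReal.mul_ne_top ENNReal.coe_ne_top ENNReal.coe_ne_top)

lemma BoundedWeights.likelihoodEstimate_mul_backwardProb (hF : F.BoundedWeights y)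
    (s : ParticleSystem X n N) (j : Fin (n + 1) → Fin N) :
    F.likelihoodEstimate y s * F.backwardProb y s j =
      F.partialEstimate y s * (F.weight y s (Fin.last n) (j (Fin.last n)) *
        F.backwardTail y s j) := by
  rw [← sum_mul_normalizedWeight (fun i => hF.weight_ne_top s (Fin.last n) i) (j (Fin.last n)),
    likelihoodEstimate, partialEstimate, backwardProb, backwardTail, ENNReal.div_eq_inv_mul,
    ENNReal.div_eq_inv_mul]
  ring

end Bounds

section Truncation

variable {N : ℕ}

/-- The particle filter up to the last time but one. -/
noncomputable def trunc (F : AuxiliaryParticleFilter M (n + 1)) : AuxiliaryParticleFilter M n where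
  instr := F.instr
  initDens := F.initDens
  adj k := F.adj k.castSucc
  r k := F.r k.castSucc
  isProbabilityMeasure_instr := F.isProbabilityMeasure_instr
  measurable_initDens := F.measurable_initDens
  measurable_adj k := F.measurable_adj k.castSucc
  measurable_r k := F.measurable_r k.castSucc
  init_eq := F.init_eq
  lintegral_r k := F.lintegral_r k.castSucc

lemma BoundedWeights.trunc {F : AuxiliaryParticleFilter M (n + 1)} {y : Fin (n + 2) → Y}
    (hF : F.BoundedWeights y) : F.trunc.BoundedWeights (fun k => y k.castSucc) where
  weightFunZero_bdd := hF.weightFunZero_bdd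
  weightFunSucc_bdd k := hF.weightFunSucc_bdd k.castSucc
  adj_bdd k := hF.adj_bdd k.castSucc

variable (F : AuxiliaryParticleFilter M (n + 1)) (y : Fin (n + 2) → Y)
  (s : ParticleSystem X n N) (x : Fin N → X) (a : Fin N → Fin N)

lemma weight_snocSystem_castSucc (k : Fin (n + 1)) (i : Fin N) :
    F.weight y (snocSystem s x a) k.castSucc i =
      F.trunc.weight (fun k => y k.castSucc) s k i := by
  induction k using Fin.cases with
  | zero =>
    change F.weightFunZero y ((snocSystem s x a).1 (Fin.castSucc 0) i) = F.weightFunZero y (s.1 0 i)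
    rw [snocSystem_fst_castSucc]
  | succ l =>
    change F.weightFunSucc y l.castSucc
      ((snocSystem s x a).1 l.castSucc.castSucc ((snocSystem s x a).2 l.castSucc i))
      ((snocSystem s x a).1 l.succ.castSucc i) =
      F.weightFunSucc y l.castSucc (s.1 l.castSucc (s.2 l i)) (s.1 l.succ i)
    rw [snocSystem_fst_castSucc, snocSystem_fst_castSucc, snocSystem_snd_castSucc]

lemma weight_snocSystem_last (i : Fin N) :
    F.weight y (snocSystem s x a) (Fin.last (n + 1)) i =
      F.weightFunSucc y (Fin.last n) (s.1 (Fin.last n) (a i)) (x i) := by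
  change F.weightFunSucc y (Fin.last n)
      ((snocSystem s x a).1 (Fin.last n).castSucc ((snocSystem s x a).2 (Fin.last n) i))
      ((snocSystem s x a).1 (Fin.last (n + 1)) i) = _
  rw [snocSystem_fst_castSucc, snocSystem_fst_last, snocSystem_snd_last]

/-- The adjusted weights from which the last generation of ancestor indices is drawn. -/
noncomputable def lastAdjustedWeight (i : Fin N) : ℝ≥0∞ :=
  F.trunc.weight (fun k => y k.castSucc) s (Fin.last n) i *
    F.adj (Fin.last n) (s.1 (Fin.last n) i)

/-- The law from which the last generation of particles and their ancestor indices is drawn. -/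
noncomputable def lastProposal (i : Fin N) (z : X) : ℝ≥0∞ :=
  normalizedWeight (F.lastAdjustedWeight y s) i * F.r (Fin.last n) (s.1 (Fin.last n) i) z

lemma filterDensity_snocSystem :
    F.filterDensity y (snocSystem s x a) =
      F.trunc.filterDensity (fun k => y k.castSucc) s *
        ∏ l, F.lastProposal y s (a l) (x l) := by
  rw [filterDensity, Fin.prod_univ_castSucc]
  simp only [auxProposal, snocSystem_fst_castSucc, snocSystem_snd_castSucc, snocSystem_snd_last,
    weight_snocSystem_castSucc, Fin.succ_castSucc, Fin.succ_last, snocSystem_fst_last]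
  rfl

lemma partialEstimate_snocSystem :
    F.partialEstimate y (snocSystem s x a) =
      F.trunc.partialEstimate (fun k => y k.castSucc) s *
        (∑ l, F.lastAdjustedWeight y s l) * (N : ℝ≥0∞)⁻¹ := by
  have hinv : (((N : ℝ≥0∞) ^ (n + 1 + 1))⁻¹) = ((N : ℝ≥0∞) ^ (n + 1))⁻¹ * (N : ℝ≥0∞)⁻¹ := by
    rw [pow_succ, ENNReal.mul_inv (Or.inr (ENNReal.natCast_ne_top N))
      (Or.inl (ENNReal.pow_ne_top (ENNReal.natCast_ne_top N)))]
  rw [partialEstimate, partialEstimate, Fin.prod_univ_castSucc, div_eq_mul_inv, div_eq_mul_inv,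
    hinv]
  simp only [snocSystem_fst_castSucc, weight_snocSystem_castSucc]
  change _ * (∑ l, F.lastAdjustedWeight y s l) * _ = _
  simp only [trunc]
  ring

lemma backwardTail_snocSystem (j : Fin (n + 1) → Fin N) (i : Fin N) :
    F.backwardTail y (snocSystem s x a) (Fin.snoc (α := fun _ => Fin N) j i) =
      F.trunc.backwardTail (fun k => y k.castSucc) s j *
        normalizedWeight (fun l => F.trunc.weight (fun k => y k.castSucc) s (Fin.last n) l *
          M.q (s.1 (Fin.last n) l) (x i)) (j (Fin.last n)) := by
  rw [backwardTail, Fin.prod_univ_castSucc]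
  simp only [snocSystem_fst_castSucc, weight_snocSystem_castSucc, Fin.succ_castSucc, Fin.succ_last,
    snocSystem_fst_last, Fin.snoc_castSucc, Fin.snoc_last]
  rfl

end Truncation

end AuxiliaryParticleFilter

namespace AuxiliaryParticleFilter

variable {X Y : Type*} [MeasurableSpace X] [MeasurableSpace Y] {M : StateSpaceModel X Y} {n N : ℕ}

instance (F : AuxiliaryParticleFilter M n) : IsProbabilityMeasure F.instr :=
  F.isProbabilityMeasure_instr

instance (F : AuxiliaryParticleFilter M n) (p : Prop) [Decidable p] :
    SigmaFinite (if p then F.instr else M.refX) := by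
  split_ifs <;> infer_instance

/-- The reference measure for the particles generated by the particle filter. -/
noncomputable def particleMeasure (F : AuxiliaryParticleFilter M n) (N : ℕ) :
    Measure (Fin (n + 1) → Fin N → X) :=
  Measure.pi (fun k : Fin (n + 1) => Measure.pi (fun _ : Fin N =>
    if k = 0 then F.instr else M.refX))

lemma lintegral_filterLaw (F : AuxiliaryParticleFilter M n) (y : Fin (n + 1) → Y)
    {G : ParticleSystem X n N → ℝ≥0∞} (hG : Measurable G) :
    ∫⁻ s, G s ∂F.filterLaw y N = ∫⁻ ξ, ∑ A, F.filterDensity y (ξ, A) * G (ξ, A)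
      ∂F.particleMeasure N := by
  have hm : Measurable fun s : ParticleSystem X n N => F.filterDensity y s * G s :=
    (F.measurable_filterDensity y).mul hG
  refine (lintegral_withDensity_eq_lintegral_mul _ (F.measurable_filterDensity y) hG).trans ?_
  refine (lintegral_prod _ hm.aemeasurable).trans (lintegral_congr fun ξ => ?_)
  rw [lintegral_count, tsum_fintype]

instance (F : AuxiliaryParticleFilter M n) (y : Fin (n + 1) → Y) : SFinite (F.filterLaw y N) := by
  unfold filterLaw
  infer_instance

/-- The sum, over all index sequences `j`, of the likelihood estimate times the backward sampling
probability of `j` times the value of `f` at the trajectory selected by `j`. -/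
noncomputable def estimatorSum (F : AuxiliaryParticleFilter M n) (y : Fin (n + 1) → Y)
    (f : Trajectory X n → ℝ≥0∞) (s : ParticleSystem X n N) : ℝ≥0∞ :=
  ∑ j : Fin (n + 1) → Fin N, F.partialEstimate y s *
    (F.weight y s (Fin.last n) (j (Fin.last n)) * F.backwardTail y s j) * f (fun k => s.1 k (j k))

lemma measurable_estimatorSum (F : AuxiliaryParticleFilter M n) (y : Fin (n + 1) → Y)
    {f : Trajectory X n → ℝ≥0∞} (hf : Measurable f) :
    Measurable fun s : ParticleSystem X n N => F.estimatorSum y f s :=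
  Finset.measurable_sum _ fun j _ => ((F.measurable_partialEstimate y).mul
    ((F.measurable_weight y _ _).mul (F.measurable_backwardTail y j))).mul
      (hf.comp (measurable_trajectory j))

section Step

variable (F : AuxiliaryParticleFilter M (n + 1)) (y : Fin (n + 2) → Y)

lemma measurable_lastProposal (s : ParticleSystem X n N) (i : Fin N) :
    Measurable (F.lastProposal y s i) :=
  (F.measurable_r_comp (Fin.last n) measurable_const measurable_id).const_mul _

lemma BoundedWeights.lastAdjustedWeight_ne_top {F : AuxiliaryParticleFilter M (n + 1)}
    {y : Fin (n + 2) → Y} (hF : F.BoundedWeights y) (s : ParticleSystem X n N) (i : Fin N) :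
    F.lastAdjustedWeight y s i ≠ ∞ :=
  ENNReal.mul_ne_top (hF.trunc.weight_ne_top s _ i) ENNReal.coe_ne_top

lemma sum_lintegral_lastProposal (hF : F.BoundedWeights y) (hN : 1 ≤ N)
    (s : ParticleSystem X n N) : ∑ i, ∫⁻ z, F.lastProposal y s i z ∂M.refX = 1 := by
  rw [← sum_normalizedWeight hN (fun i => hF.lastAdjustedWeight_ne_top s i)]
  refine Finset.sum_congr rfl fun i _ => ?_
  refine (lintegral_const_mul _
    (F.measurable_r_comp (Fin.last n) measurable_const measurable_id)).trans ?_
  simp only [id_eq, F.lintegral_r, mul_one]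

/-- The contribution of a particle of the last generation, located at `z` and with ancestor `b`,
to `estimatorSum`. -/
noncomputable def lastContribution (f : Trajectory X (n + 1) → ℝ≥0∞) (s : ParticleSystem X n N)
    (b : Fin N) (z : X) : ℝ≥0∞ :=
  ∑ j : Fin (n + 1) → Fin N, F.trunc.partialEstimate (fun k => y k.castSucc) s *
    (∑ l, F.lastAdjustedWeight y s l) * (N : ℝ≥0∞)⁻¹ *
    (F.weightFunSucc y (Fin.last n) (s.1 (Fin.last n) b) z *
      (F.trunc.backwardTail (fun k => y k.castSucc) s j *
        normalizedWeight (fun l => F.trunc.weight (fun k => y k.castSucc) s (Fin.last n) l *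
          M.q (s.1 (Fin.last n) l) z) (j (Fin.last n)))) *
    f (Fin.snoc (α := fun _ => X) (fun k => s.1 k (j k)) z)

lemma measurable_lastContribution {f : Trajectory X (n + 1) → ℝ≥0∞} (hf : Measurable f)
    (s : ParticleSystem X n N) (b : Fin N) : Measurable (F.lastContribution y f s b) := by
  refine Finset.measurable_sum _ fun j _ => Measurable.mul (Measurable.const_mul
    (Measurable.mul ?_ (Measurable.const_mul (measurable_normalizedWeight (fun l => ?_) _) _)) _) ?_
  · exact F.measurable_weightFunSucc_comp y _ measurable_const measurable_id
  · exact (M.measurable_q_comp measurable_const measurable_id).const_mul _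
  · exact hf.comp (measurable_snoc.comp (measurable_prodMk_left (x := fun k => s.1 k (j k))))

lemma estimatorSum_snocSystem (f : Trajectory X (n + 1) → ℝ≥0∞) (s : ParticleSystem X n N)
    (x : Fin N → X) (a : Fin N → Fin N) :
    F.estimatorSum y f (snocSystem s x a) = ∑ i, F.lastContribution y f s (a i) (x i) := by
  unfold estimatorSum lastContribution
  rw [sum_fun_snoc, Finset.sum_comm]
  simp only [partialEstimate_snocSystem, weight_snocSystem_last, backwardTail_snocSystem,
    trajectory_snocSystem, Fin.snoc_last]

lemma sum_lastProposal_mul_lastContribution (hF : F.BoundedWeights y)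
    (f : Trajectory X (n + 1) → ℝ≥0∞) (s : ParticleSystem X n N) (z : X) :
    ∑ b, F.lastProposal y s b z * F.lastContribution y f s b z = (N : ℝ≥0∞)⁻¹ *
      ∑ j : Fin (n + 1) → Fin N, F.trunc.partialEstimate (fun k => y k.castSucc) s *
        (F.trunc.weight (fun k => y k.castSucc) s (Fin.last n) (j (Fin.last n)) *
          F.trunc.backwardTail (fun k => y k.castSucc) s j) *
        (M.g z (y (Fin.last (n + 1))) * M.q (s.1 (Fin.last n) (j (Fin.last n))) z *
          f (Fin.snoc (α := fun _ => X) (fun k => s.1 k (j k)) z)) := by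
  have hb : ∀ b : Fin N, (∑ l, F.lastAdjustedWeight y s l) * (F.lastProposal y s b z *
      F.weightFunSucc y (Fin.last n) (s.1 (Fin.last n) b) z) =
      M.g z (y (Fin.last (n + 1))) * (F.trunc.weight (fun k => y k.castSucc) s (Fin.last n) b *
        M.q (s.1 (Fin.last n) b) z) := fun b => by
    have h1 := sum_mul_normalizedWeight (fun i => hF.lastAdjustedWeight_ne_top s i) b
    have h2 := hF.adj_mul_r_mul_weightFunSucc (Fin.last n) (s.1 (Fin.last n) b) z
    rw [lastProposal, mul_assoc, ← mul_assoc (∑ l, _), h1, lastAdjustedWeight, mul_assoc,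
      ← mul_assoc (F.adj (Fin.last n) _ : ℝ≥0∞), h2, Fin.succ_last]
    ring
  simp only [lastContribution]
  set W := ∑ l, F.lastAdjustedWeight y s l
  simp_rw [Finset.mul_sum]
  rw [Finset.sum_comm]
  refine Finset.sum_congr rfl fun j _ => ?_
  have hw : ∀ l, F.trunc.weight (fun k => y k.castSucc) s (Fin.last n) l *
      M.q (s.1 (Fin.last n) l) z ≠ ∞ := fun l =>
    ENNReal.mul_ne_top (hF.trunc.weight_ne_top s _ l) ENNReal.coe_ne_top
  have hj := sum_mul_normalizedWeight hw (j (Fin.last n))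
  set nw := normalizedWeight (fun l => F.trunc.weight (fun k => y k.castSucc) s (Fin.last n) l *
    M.q (s.1 (Fin.last n) l) z) (j (Fin.last n))
  set pe := F.trunc.partialEstimate (fun k => y k.castSucc) s
  set bt := F.trunc.backwardTail (fun k => y k.castSucc) s j
  set v := f (Fin.snoc (α := fun _ => X) (fun k => s.1 k (j k)) z)
  have hterm : ∀ b, F.lastProposal y s b z * (pe * W * (N : ℝ≥0∞)⁻¹ *
      (F.weightFunSucc y (Fin.last n) (s.1 (Fin.last n) b) z * (bt * nw)) * v) =
      (pe * (N : ℝ≥0∞)⁻¹ * bt * v * M.g z (y (Fin.last (n + 1))) * nw) *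
        (F.trunc.weight (fun k => y k.castSucc) s (Fin.last n) b *
          M.q (s.1 (Fin.last n) b) z) := fun b => by
    calc _ = pe * (N : ℝ≥0∞)⁻¹ * bt * nw * v * (W * (F.lastProposal y s b z *
          F.weightFunSucc y (Fin.last n) (s.1 (Fin.last n) b) z)) := by ring
      _ = _ := by rw [hb]; ring
  simp_rw [hterm]
  rw [← Finset.mul_sum, mul_assoc, mul_comm nw, hj]
  ring

/-- Integrating out the last generation of particles. -/
lemma lintegral_estimatorSum_snocSystem (hF : F.BoundedWeights y) (hN : 1 ≤ N)
    {f : Trajectory X (n + 1) → ℝ≥0∞} (hf : Measurable f) (s : ParticleSystem X n N) :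
    ∫⁻ x, ∑ a : Fin N → Fin N, (∏ l, F.lastProposal y s (a l) (x l)) *
        F.estimatorSum y f (snocSystem s x a) ∂Measure.pi (fun _ : Fin N => M.refX) =
      F.trunc.estimatorSum (fun k => y k.castSucc) (M.extend (y (Fin.last (n + 1))) f) s := by
  have hp := F.measurable_lastProposal y s
  have hc := F.measurable_lastContribution y hf s
  have hN0 : (N : ℝ≥0∞) ≠ 0 := by exact_mod_cast (by omega : N ≠ 0)
  have hm : ∀ (i : Fin N) (a : Fin N → Fin N), Measurable fun x : Fin N → X =>
      (∏ l, F.lastProposal y s (a l) (x l)) * F.lastContribution y f s (a i) (x i) :=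
    fun i a => by fun_prop
  have hpc : ∀ i, Measurable fun z => F.lastProposal y s i z * F.lastContribution y f s i z :=
    fun i => (hp i).mul (hc i)
  simp_rw [estimatorSum_snocSystem, Finset.mul_sum]
  simp_rw [Finset.sum_comm (s := (Finset.univ : Finset (Fin N → Fin N)))]
  rw [lintegral_finsetSum _ fun i _ => Finset.measurable_sum _ fun a _ => hm i a]
  simp_rw [lintegral_pi_sum_prod_mul M.refX hp hc (F.sum_lintegral_lastProposal y hF hN s)]
  rw [Finset.sum_const, Finset.card_univ, Fintype.card_fin, nsmul_eq_mul,
    ← lintegral_finsetSum _ fun i _ => hpc i]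
  simp_rw [F.sum_lastProposal_mul_lastContribution y hF f s]
  have hint : ∀ j : Fin (n + 1) → Fin N, Measurable fun z =>
      (M.g z (y (Fin.last (n + 1))) : ℝ≥0∞) * M.q (s.1 (Fin.last n) (j (Fin.last n))) z *
        f (Fin.snoc (α := fun _ => X) (fun k => s.1 k (j k)) z) := fun j =>
    (M.measurable_extend_integrand _ hf).comp
      (measurable_prodMk_left (x := fun k => s.1 k (j k)))
  rw [lintegral_const_mul _ (Finset.measurable_sum _ fun j _ => (hint j).const_mul _), ← mul_assoc,
    ENNReal.mul_inv_cancel hN0 (ENNReal.natCast_ne_top N), one_mul,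
    lintegral_finsetSum _ fun j _ => (hint j).const_mul _]
  refine Finset.sum_congr rfl fun j _ => ?_
  rw [lintegral_const_mul _ (hint j), StateSpaceModel.extend]

end Step

lemma lintegral_estimatorSum_zero (F : AuxiliaryParticleFilter M 0) (y : Fin 1 → Y) (hN : 1 ≤ N)
    {f : Trajectory X 0 → ℝ≥0∞} (hf : Measurable f) :
    ∫⁻ s : ParticleSystem X 0 N, F.estimatorSum y f s ∂F.filterLaw y N =
      ∫⁻ x, f x ∂M.jointMeasure y := by
  have hN0 : (N : ℝ≥0∞) ≠ 0 := by exact_mod_cast (by omega : N ≠ 0)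
  have hf' : Measurable fun z : X => f fun _ => z :=
    hf.comp (measurable_pi_lambda _ fun _ => measurable_id)
  have hm : Measurable fun z : X => F.weightFunZero y z * f fun _ => z :=
    (F.measurable_weightFunZero y).mul hf'
  have hinit : ∫⁻ x, f x ∂M.jointMeasure y =
      ∫⁻ z, F.weightFunZero y z * f (fun _ => z) ∂F.instr := by
    rw [M.lintegral_jointMeasure_zero y hf, F.init_eq]
    refine (lintegral_withDensity_eq_lintegral_mul _ F.measurable_initDens.coe_nnreal_ennreal
      ((M.measurable_g_left _).mul hf')).trans (lintegral_congr fun z => ?_)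
    simp only [Pi.mul_apply, weightFunZero]
    ring
  have hsum : ∀ ξ : Fin 1 → Fin N → X, ∑ A : Fin 0 → Fin N → Fin N,
      F.filterDensity y (ξ, A) * F.estimatorSum y f (ξ, A) =
      ∑ j : Fin 1 → Fin N, (N : ℝ≥0∞)⁻¹ *
        (F.weightFunZero y (ξ 0 (j 0)) * f (fun _ => ξ 0 (j 0))) := fun ξ => by
    rw [Fintype.sum_unique]
    have hconst : ∀ j : Fin 1 → Fin N, (fun k => ξ k (j k)) = fun _ => ξ 0 (j 0) := fun j => by
      ext k
      rw [Fin.eq_zero k]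
    have hw : ∀ i, F.weight y (ξ, (default : Fin 0 → Fin N → Fin N)) 0 i =
      F.weightFunZero y (ξ 0 i) := fun i => rfl
    simp only [filterDensity, estimatorSum, partialEstimate, backwardTail, Finset.univ_eq_empty,
      Finset.prod_empty, one_mul, mul_one, zero_add, pow_one, one_div, hconst, Fin.last_zero, hw, mul_assoc]
  have hcoord : ∀ j : Fin 1 → Fin N, ∫⁻ ξ : Fin 1 → Fin N → X,
      F.weightFunZero y (ξ 0 (j 0)) * f (fun _ => ξ 0 (j 0)) ∂F.particleMeasure N =
      ∫⁻ z, F.weightFunZero y z * f (fun _ => z) ∂F.instr := fun j => by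
    have hμ : F.particleMeasure N =
        Measure.pi fun _ : Fin 1 => Measure.pi fun _ : Fin N => F.instr := by
      unfold particleMeasure
      congr 1
      ext1 k
      rw [if_pos (Fin.eq_zero k)]
    have h1 := measurePreserving_eval (fun _ : Fin 1 => Measure.pi fun _ : Fin N => F.instr) 0
    have h2 := measurePreserving_eval (fun _ : Fin N => F.instr) (j 0)
    rw [hμ]
    exact (h2.comp h1).lintegral_comp hm
  have hmj : ∀ j : Fin 1 → Fin N, Measurable fun ξ : Fin 1 → Fin N → X =>
      F.weightFunZero y (ξ 0 (j 0)) * f (fun _ => ξ 0 (j 0)) := fun j =>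
    hm.comp ((measurable_pi_apply (j 0)).comp (measurable_pi_apply 0))
  rw [lintegral_filterLaw F y (F.measurable_estimatorSum y hf), hinit]
  simp_rw [hsum]
  rw [lintegral_finsetSum _ fun j _ => (hmj j).const_mul _]
  simp_rw [lintegral_const_mul _ (hmj _), hcoord]
  rw [Finset.sum_const, Finset.card_univ, nsmul_eq_mul, ← mul_assoc]
  simp [ENNReal.mul_inv_cancel hN0]

/-- The expectation, under the law of the particle filter, of `estimatorSum` is the integral with
respect to the unnormalised smoothing distribution. -/
lemma lintegral_estimatorSum (F : AuxiliaryParticleFilter M n) (y : Fin (n + 1) → Y)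
    (hF : F.BoundedWeights y) (hN : 1 ≤ N) {f : Trajectory X n → ℝ≥0∞} (hf : Measurable f) :
    ∫⁻ s : ParticleSystem X n N, F.estimatorSum y f s ∂F.filterLaw y N =
      ∫⁻ x, f x ∂M.jointMeasure y := by
  induction n with
  | zero => exact F.lintegral_estimatorSum_zero y hN hf
  | succ n ih =>
    rw [M.lintegral_jointMeasure_succ y hf,
      ← ih F.trunc _ hF.trunc (M.measurable_extend _ hf),
      lintegral_filterLaw _ _ (F.measurable_estimatorSum y hf),
      lintegral_filterLaw _ _ (F.trunc.measurable_estimatorSum _ (M.measurable_extend _ hf))]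
    have hm : ∀ A, Measurable fun ξ : Fin (n + 2) → Fin N → X =>
        F.filterDensity y (ξ, A) * F.estimatorSum y f (ξ, A) := fun A =>
      ((F.measurable_filterDensity y).comp (measurable_prodMk_right (y := A))).mul
        ((F.measurable_estimatorSum y hf).comp (measurable_prodMk_right (y := A)))
    unfold particleMeasure
    rw [lintegral_pi_snoc _ (Finset.measurable_sum _ fun A _ => hm A)]
    simp only [Fin.castSucc_eq_zero_iff, Fin.last_eq_zero_iff, Nat.add_eq_zero_iff, one_ne_zero,
      and_false, if_false]
    refine lintegral_congr fun ξ => ?_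
    simp_rw [sum_fun_snoc (n := n) (β := Fin N → Fin N)]
    change ∫⁻ x, ∑ A, ∑ a, F.filterDensity y (snocSystem (ξ, A) x a) *
      F.estimatorSum y f (snocSystem (ξ, A) x a) ∂_ = _
    simp_rw [filterDensity_snocSystem, mul_assoc, ← Finset.mul_sum]
    have hm' : ∀ A : Fin n → Fin N → Fin N, Measurable fun x : Fin N → X =>
        ∑ a : Fin N → Fin N, (∏ l, F.lastProposal y (ξ, A) (a l) (x l)) *
          F.estimatorSum y f (snocSystem (ξ, A) x a) := fun A => by
      have hp := F.measurable_lastProposal y (ξ, A)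
      have hc := F.measurable_lastContribution y hf (ξ, A)
      simp_rw [estimatorSum_snocSystem]
      fun_prop
    rw [lintegral_finsetSum _ fun A _ => (hm' A).const_mul _]
    refine Finset.sum_congr rfl fun A _ => ?_
    rw [lintegral_const_mul _ (hm' A), F.lintegral_estimatorSum_snocSystem y hF hN hf]

end AuxiliaryParticleFilter

namespace AuxiliaryParticleFilter

variable {X Y : Type*} [MeasurableSpace X] [MeasurableSpace Y] {M : StateSpaceModel X Y} {n N : ℕ}

lemma lintegral_ffbsLaw (F : AuxiliaryParticleFilter M n) (y : Fin (n + 1) → Y)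
    {G : Trajectory X n × ParticleSystem X n N → ℝ≥0∞} (hG : Measurable G) :
    ∫⁻ p, G p ∂F.ffbsLaw y N = ∫⁻ s, ∑ j, F.backwardProb y s j * G (fun k => s.1 k (j k), s)
      ∂F.filterLaw y N := by
  have hb : Measurable fun p : ParticleSystem X n N × (Fin (n + 1) → Fin N) =>
      F.backwardProb y p.1 p.2 :=
    measurable_from_prod_countable_left fun j => F.measurable_backwardProb y j
  have hsel : Measurable fun p : ParticleSystem X n N × (Fin (n + 1) → Fin N) =>
      ((fun k => p.1.1 k (p.2 k) : Trajectory X n), p.1) :=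
    measurable_from_prod_countable_left fun j =>
      (measurable_trajectory j).prodMk measurable_id
  have hGs := hG.comp hsel
  have hm : Measurable fun p : ParticleSystem X n N × (Fin (n + 1) → Fin N) =>
      F.backwardProb y p.1 p.2 * G (fun k => p.1.1 k (p.2 k), p.1) := hb.mul hGs
  rw [ffbsLaw, lintegral_map hG hsel]
  refine (lintegral_withDensity_eq_lintegral_mul _ hb hGs).trans ?_
  refine (lintegral_prod _ hm.aemeasurable).trans (lintegral_congr fun s => ?_)
  rw [lintegral_count, tsum_fintype]

instance (F : AuxiliaryParticleFilter M n) (y : Fin (n + 1) → Y) : SFinite (F.ffbsLaw y N) := by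
  unfold ffbsLaw
  infer_instance

/-- Unbiasedness of the estimates obtained from forward filtering backward sampling. -/
lemma lintegral_likelihoodEstimate_mul_ffbsLaw (F : AuxiliaryParticleFilter M n)
    (y : Fin (n + 1) → Y) (hF : F.BoundedWeights y) (hN : 1 ≤ N) {f : Trajectory X n → ℝ≥0∞}
    (hf : Measurable f) :
    ∫⁻ p, F.likelihoodEstimate y p.2 * f p.1 ∂F.ffbsLaw y N = ∫⁻ x, f x ∂M.jointMeasure y := by
  have hm : Measurable fun p : Trajectory X n × ParticleSystem X n N =>
      F.likelihoodEstimate y p.2 * f p.1 :=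
    ((F.measurable_likelihoodEstimate y).comp measurable_snd).mul (hf.comp measurable_fst)
  rw [lintegral_ffbsLaw F y hm, ← F.lintegral_estimatorSum y hF hN hf]
  refine lintegral_congr fun s => Finset.sum_congr rfl fun j _ => ?_
  rw [← hF.likelihoodEstimate_mul_backwardProb s j]
  ring

lemma lintegral_likelihoodEstimate_ffbsLaw (F : AuxiliaryParticleFilter M n)
    (y : Fin (n + 1) → Y) (hF : F.BoundedWeights y) (hN : 1 ≤ N) :
    ∫⁻ p, F.likelihoodEstimate y p.2 ∂F.ffbsLaw y N = M.likelihood y := by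
  have h := F.lintegral_likelihoodEstimate_mul_ffbsLaw y hF hN (f := 1) measurable_one
  simpa [StateSpaceModel.likelihood] using h

/-- The importance weight function of the sampler based on forward filtering backward sampling. -/
noncomputable def ffbsWeight (F : AuxiliaryParticleFilter M n) (y : Fin (n + 1) → Y)
    (p : Trajectory X n × ParticleSystem X n N) : ℝ≥0∞ :=
  F.likelihoodEstimate y p.2

lemma measurable_ffbsWeight (F : AuxiliaryParticleFilter M n) (y : Fin (n + 1) → Y) :
    Measurable (F.ffbsWeight y : Trajectory X n × ParticleSystem X n N → ℝ≥0∞) :=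
  (F.measurable_likelihoodEstimate y).comp measurable_snd

/-- The trajectory has the smoothing distribution under the target of the sampler. -/
lemma map_fst_imhTarget (F : AuxiliaryParticleFilter M n) (y : Fin (n + 1) → Y)
    (hF : F.BoundedWeights y) (hN : 1 ≤ N) :
    (imhTarget (F.ffbsLaw y N) (F.ffbsWeight y)).map Prod.fst = M.smoothing y := by
  ext A hA
  have h := F.lintegral_likelihoodEstimate_mul_ffbsLaw y hF hN (f := A.indicator 1)
    (measurable_one.indicator hA)
  have hA' : MeasurableSet (Prod.fst ⁻¹' A : Set (Trajectory X n × ParticleSystem X n N)) :=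
    measurable_fst hA
  rw [Measure.map_apply measurable_fst hA, imhTarget, StateSpaceModel.smoothing,
    Measure.smul_apply, Measure.smul_apply, withDensity_apply _ hA', ← lintegral_indicator hA']
  unfold ffbsWeight
  rw [F.lintegral_likelihoodEstimate_ffbsLaw y hF hN]
  congr 1
  rw [lintegral_indicator_one hA] at h
  rw [← h]
  refine lintegral_congr fun p => ?_
  by_cases hp : p.1 ∈ A <;> simp [hp]

lemma mhTransition_eq_imhKernel (F : AuxiliaryParticleFilter M n) (y : Fin (n + 1) → Y)
    (p : Trajectory X n × ParticleSystem X n N)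
    {B : Set (Trajectory X n × ParticleSystem X n N)} (hB : MeasurableSet B) :
    F.mhTransition y p B = imhKernel (F.ffbsLaw y N) (F.measurable_ffbsWeight y) p B :=
  (imhKernel_apply (F.measurable_ffbsWeight y) p hB).symm

lemma IsMHChain.isProbabilityMeasure_ffbsLaw {F : AuxiliaryParticleFilter M n}
    {y : Fin (n + 1) → Y} {Ω : Type*} [MeasurableSpace Ω] {P : Measure Ω} [IsProbabilityMeasure P]
    {S : ℕ → Ω → Trajectory X n × ParticleSystem X n N} (hS : F.IsMHChain y P S) :
    IsProbabilityMeasure (F.ffbsLaw y N) := by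
  have h := hS.markov 0 Set.univ Set.univ MeasurableSet.univ MeasurableSet.univ
  have h1 : ∀ p : Trajectory X n × ParticleSystem X n N,
      F.mhTransition y p Set.univ = F.ffbsLaw y N Set.univ := fun p => by
    have : ∀ s s' : ParticleSystem X n N, F.acceptProb y s s' ≤ 1 := fun s s' => min_le_left _ _
    simp [mhTransition, add_tsub_cancel_of_le (this _ _)]
  refine ⟨?_⟩
  simpa [h1] using h.symm

end AuxiliaryParticleFilter

lemma abs_le_supNorm {α : Type*} {h : α → ℝ} (hb : ∃ b : ℝ, ∀ x, |h x| ≤ b) (x : α) :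
    |h x| ≤ supNorm h := by
  obtain ⟨b, hb⟩ := hb
  exact le_ciSup (f := fun x => |h x|) ⟨b, Set.forall_mem_range.2 hb⟩ x

theorem mainTheorem4 {X Y : Type*}
    [TopologicalSpace X] [PolishSpace X] [MeasurableSpace X] [BorelSpace X]
    [TopologicalSpace Y] [PolishSpace Y] [MeasurableSpace Y] [BorelSpace Y]
    (M : StateSpaceModel X Y) (n : ℕ) (y : Fin (n + 1) → Y)
    (hy : M.likelihood y ≠ 0)
    (F : AuxiliaryParticleFilter M n) (hF : F.BoundedWeights y)
    (N : ℕ) (hN : 1 ≤ N) :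
    ∃ c : ℝ, 0 < c ∧
      ∀ h : Trajectory X n → ℝ, Measurable h → (∃ b : ℝ, ∀ x, |h x| ≤ b) →
      ∀ m : ℕ, 1 ≤ m → ∀ x : Trajectory X n, ∀ ε : ℝ, 0 < ε →
      ∀ (Ω : Type*) [MeasurableSpace Ω] (P : Measure Ω) [IsProbabilityMeasure P]
        (S : ℕ → Ω → Trajectory X n × ParticleSystem X n N),
        F.IsMHChain y P S → (∀ᵐ ω ∂P, (S 0 ω).1 = x) →
        P.real {ω | ε ≤ |(1 / (m : ℝ)) * ∑ l ∈ Finset.range (m + 1), h (S l ω).1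
            - ∫ z, h z ∂(M.smoothing y)|}
          ≤ c * Real.exp (-((m : ℝ) / c) *
              min (ε ^ 2 / supNorm h ^ 2) (ε / supNorm h)) := by
  obtain ⟨B, hBfin, hB0, hB⟩ := hF.exists_likelihoodEstimate_le hN
  obtain ⟨δ, hδ0, hδ1⟩ := ENNReal.lt_iff_exists_nnreal_btwn.1
    (show 0 < min 1 (M.likelihood y / B) from
      lt_min one_pos (ENNReal.div_pos hy hBfin))
  have hδpos : 0 < δ := by exact_mod_cast hδ0
  have hδle : δ ≤ 1 := by exact_mod_cast (hδ1.trans_le (min_le_left _ _)).le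
  have hδB : δ * B ≤ M.likelihood y :=
    (ENNReal.le_div_iff_mul_le (Or.inl hB0) (Or.inl hBfin)).1
      (hδ1.trans_le (min_le_right _ _)).le
  have hδpos' : (0 : ℝ) < δ := hδpos
  refine ⟨max (2 * Real.exp 3) (8 / (δ : ℝ) ^ 2), lt_max_of_lt_left (by positivity), ?_⟩
  intro h hh hb m hm x ε hε Ω _ P _ S hS _
  have := hS.isProbabilityMeasure_ffbsLaw
  have hw := F.measurable_ffbsWeight (N := N) y
  have hwB : ∀ p, F.ffbsWeight y p ≤ B := fun p => hB p.2
  have hwfin : ∀ p, F.ffbsWeight (N := N) y p ≠ ∞ := fun p => ((hwB p).trans_lt hBfin.lt_top).ne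
  have hint : ∫⁻ p, F.ffbsWeight y p ∂F.ffbsLaw y N = M.likelihood y :=
    F.lintegral_likelihoodEstimate_ffbsLaw y hF hN
  have hintfin : ∫⁻ p, F.ffbsWeight y p ∂F.ffbsLaw y N ≠ ∞ :=
    ((lintegral_mono hwB).trans_lt (by simpa using hBfin.lt_top)).ne
  have hint0 : ∫⁻ p, F.ffbsWeight y p ∂F.ffbsLaw y N ≠ 0 := hint ▸ hy
  have := isProbabilityMeasure_imhTarget hint0 hintfin
  have hmean : ∫ p, h p.1 ∂imhTarget (F.ffbsLaw y N) (F.ffbsWeight y) =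
      ∫ z, h z ∂M.smoothing y := by
    rw [← F.map_fst_imhTarget y hF hN,
      integral_map measurable_fst.aemeasurable hh.aestronglyMeasurable]
  have key := measureReal_abs_average_sub_ge_le (invariant_imhKernel hw hwfin) hδpos hδle
    (smul_imhTarget_le_imhKernel hw hB0 hwB hBfin (hδB.trans_eq hint.symm) hint0 hintfin)
    (hh.comp measurable_fst) (fun p => abs_le_supNorm hb p.1) hS.measurable
    (fun l A B hA hB => by
      simp_rw [← F.mhTransition_eq_imhKernel y _ hB]
      exact hS.markov l A B hA hB) hm hε
  simp only [Function.comp_apply, hmean] at key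
  refine key.trans (mul_le_mul (le_max_left _ _) (Real.exp_le_exp.2 ?_) (Real.exp_nonneg _)
    (le_max_of_le_left (by positivity)))
  rw [neg_mul, neg_le_neg_iff]
  have hc : (m : ℝ) / max (2 * Real.exp 3) (8 / (δ : ℝ) ^ 2) ≤ m * ((δ : ℝ) ^ 2 / 8) := by
    rw [div_eq_mul_inv]
    refine mul_le_mul_of_nonneg_left ?_ m.cast_nonneg
    have h8 := inv_anti₀ (by positivity) (le_max_right (2 * Real.exp 3) (8 / (δ : ℝ) ^ 2))
    rwa [inv_div] at h8
  exact (mul_le_mul_of_nonneg_left (min_le_left _ _) (by positivity)).trans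
    (mul_le_mul_of_nonneg_right hc (by positivity))
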